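/- **Setting.** Fix $T>0$, $\mu\in\mathbb R$, $\sigma\ge 0$, $S_0,X_0\in\mathbb R$, $\eta\ge 0$, $\nu\geq 0$, $\lambda>0$, a probability space $(\Omega,\mathcal F,\mathbb P)$ with a filtration $(\mathcal F_t)_{t\in[0,T]}$ satisfying the usual conditions, and a standard $(\mathcal F_t)$-Brownian motion $W$. Elements of the extended tensor algebra $T((\mathbb R^2))$ are identified with their coefficients $\ell^{w}$ on words $w$ in the letters $\mathbf 1,\mathbf 2$; $\otimes$ is concatenation, $\mathbin{\sqcup\!\sqcup}$ the shuffle product, $\ell|_u$ is defined by $(\ell|_u)^v=\ell^{vu}$, $\ell|_q$ by $(\ell|_q)^v=\sum_u \ell^{vu}q^u$, $\langle \ell,q\rangle=\sum_w\ell^wq^w$, and $T^{\le N}(\mathbb R^2)$ is the set of $\ell$ with $\ell^w=0$ for all words of length $>N$. Let $\xi$ be an element with finitely many nonzero coefficients, and $$\xi_t:=\xi|_{\mathcal E_{T-t}},\qquad \mathcal E_t:=\exp_\otimes\big((\mathbf 1+\tfrac{\sigma^2}{2}\mathbf{22})t\big),\qquad t\in[0,T].$$ Let $\tilde M$ be the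 least $N$ such that $\xi_t|_{\mathbf 2}\in T^{\le N}(\mathbb R^2)$ for all $t\in[0,T]$, let $p:=2\vee 2\tilde M\mathbb 1_{\{\nu>0\}}$, and let $\mathcal A$ be the set of real progressively measurable processes $\theta$ on $[0,T]$ with $\mathbb E\int_0^T\theta_t^p\,dt<\infty$, with $\|\theta\|_{\mathcal A}:=(\mathbb E\int_0^T\theta_t^p\,dt)^{1/p}$. For $\theta\in\mathcal A$ put $$X^\theta_t=X_0+\int_0^t\theta_s\,ds,\qquad P^\theta_t=S_0+\mu t+\sigma W_t+\nu(X^\theta_t-X_0),$$ let $\hat{\mathbb P}^\theta_{s,t}$ be the (Stratonovich) signature of $u\mapsto(u,P^\theta_u)$ over $[s,t]$, $\hat{\mathbb P}^\theta_t:=\hat{\mathbb P}^\theta_{0,t}$, and $$\Gamma^\theta_{t,s}=\langle \xi_s|_{\mathbf 2},\hat{\mathbb P}^\theta_t\otimes\mathbf 2\otimes\hat{\mathbb P}^\theta_{t,s}\rangle,\qquad \tilde\Gamma^\theta_{t,s}=\langle (\xi_s|_{\mathbf 2})^{\mathbin{\sqcup\!\sqcup}2},\hat{\mathbb P}^\theta_t\otimes\mathbf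 2\otimes\hat{\mathbb P}^\theta_{t,s}\rangle .$$ Define the gain functional $$J(\theta)=\mathbb E\int_0^T\Big[(\mu+\nu\theta_t)\big(X^\theta_t-\langle\xi_t|_{\mathbf 2},\hat{\mathbb P}^\theta_t\rangle\big)-\eta\theta_t^2-\tfrac{\lambda}{2}\sigma^2\big(X^\theta_t-\langle\xi_t|_{\mathbf 2},\hat{\mathbb P}^\theta_t\rangle\big)^2\Big]dt$$ and the operators $$(\mathbf A\theta)_t=X^\theta_t-\langle\xi_t|_{\mathbf 2},\hat{\mathbb P}^\theta_t\rangle+\int_t^T\mathbb E\big(\theta_s(1-\nu\Gamma^\theta_{t,s})\,|\,\mathcal F_t\big)ds,$$ $$(\mathbf B\theta)_t=\int_t^T\mathbb E\big(X^\theta_s(1-\nu\Gamma^\theta_{t,s})\,|\,\mathcal F_t\big)ds+\int_t^T\mathbb E\big(\tfrac12\nu\tilde\Gamma^\theta_{t,s}-\langle\xi_s|_{\mathbf 2},\hat{\mathbb P}^\theta_s\rangle\,|\,\mathcal F_t\big)ds,$$ $$(\mathbf C\theta)_t=(T-t)-\int_t^T\mathbb E(\nu\Gamma^\theta_{t,s}\,|\,\mathcal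 F_t)\,ds .$$ Here $\int_t^T\mathbb E(Y_s|\mathcal F_t)ds$ is understood as $\mathbb E(\int_t^TY_sds\,|\,\mathcal F_t)$, and $\langle f,g\rangle_{L_2}:=\mathbb E\int_0^Tf_tg_t\,dt$ is computed as $\int_0^T\mathbb E(f_tg_t)\,dt$. **Proposition.** Suppose that $\nu>0$, that $\xi_t|_{\mathbf 2}\in T^{\le 1}(\mathbb R^2)$ for all $t\in[0,T]$, and that for a given $0<\varepsilon<2\eta$ $$\frac1\nu\Big(1-\frac{2\eta-\varepsilon}{T\nu}\Big)\le \xi_t^{\mathbf{22}}\le\frac1\nu,\qquad t\in[0,T].$$ Then the monotonicity condition holds with this $\varepsilon$: for all $\theta,\phi\in\mathcal A$, $$\Big\langle -2\eta(\theta-\phi)+\varepsilon\big(\|\theta\|_{\mathcal A}^{2-p}\theta^{p-1}-\|\phi\|_{\mathcal A}^{2-p}\phi^{p-1}\big)+\nu(\mathbf A\theta-\mathbf A\phi)-\lambda\sigma^2(\mathbf B\theta-\mathbf B\phi)+\mu(\mathbf C\theta-\mathbf C\phi),\ \theta-\phi\Big\rangle_{L_2}\le 0,$$ the integrals in the pairing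 being absolutely convergent. Moreover, for every $\theta\in\mathcal A$ the integrand of $J(\theta)$ is $dt\otimes\mathbb P$-integrable, and there is an optimal control, i.e. $\theta^*\in\mathcal A$ with $J(\theta^*)=\sup_{\theta\in\mathcal A}J(\theta)$, which is unique up to $dt\otimes\mathbb P$-null sets. -/

import Mathlib

open MeasureTheory ProbabilityTheory Filter Topology

noncomputable section

namespace SigHedging

/-! ### The tensor algebra over `ℝ²` in the basis of words -/

/-- Words over the two-letter alphabet. The letter **1** of the mathematical text is `(0 : Fin 2)`,
the letter **2** is `(1 : Fin 2)`; they are called `L1` and `L2` below. -/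
abbrev Word := List (Fin 2)

/-- The letter **1** (time). -/
abbrev L1 : Fin 2 := 0

/-- The letter **2** (price). -/
abbrev L2 : Fin 2 := 1

/-- The extended tensor algebra `T((ℝ²))`: an element is given by its coefficients on words. -/
abbrev TensorSeries := Word → ℝ

/-- The basis element of `T((ℝ²))` attached to a word. -/
def basisWord (w : Word) : TensorSeries := Pi.single w 1

/-- Membership in the truncated tensor algebra `T^{≤ N}(ℝ²)`. -/
def IsTruncatedAt (N : ℕ) (l : TensorSeries) : Prop := ∀ w : Word, N < w.length → l w = 0

/-- The tensor product `p ⊗ q` in `T((ℝ²))`: sum over all splittings of a word in two. -/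
def tensorMul (p q : TensorSeries) : TensorSeries := fun w =>
  ∑ k ∈ Finset.range (w.length + 1), p (w.take k) * q (w.drop k)

/-- Tensor powers `p^{⊗ k}`. -/
def tensorPow (p : TensorSeries) : ℕ → TensorSeries
  | 0 => basisWord []
  | k + 1 => tensorMul p (tensorPow p k)

/-- The tensor exponential `∑ₖ p^{⊗ k} / k!`. -/
def tensorExp (p : TensorSeries) : TensorSeries := fun w =>
  ∑' k : ℕ, tensorPow p k w / (Nat.factorial k : ℝ)

/-- The projection `l|_u` on a word `u`: its coefficient at `v` is the coefficient of `l` at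
`vu`. -/
def projWord (l : TensorSeries) (u : Word) : TensorSeries := fun v => l (v ++ u)

/-- The projection `l|_q` on a tensor series `q`, with coefficients `∑_u l^{vu} q^u`
(a finite sum if `l` has finitely many nonzero coefficients). -/
def projSeries (l q : TensorSeries) : TensorSeries := fun v => ∑ᶠ u : Word, l (v ++ u) * q u

/-- The bracket `⟨l, p⟩ = ∑_w l^w p^w` (a finite sum if `l` has finitely many nonzero
coefficients). -/
def bracket (l p : TensorSeries) : ℝ := ∑ᶠ w : Word, l w * p w

/-- Shuffles of two words that are written backwards, as a list with multiplicities: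
recursion on the last letters. -/
def shuffleRev : Word → Word → List Word
  | [], w => [w]
  | i :: v, [] => [i :: v]
  | i :: v, j :: w =>
      (shuffleRev v (j :: w)).map (fun u => i :: u) ++ (shuffleRev (i :: v) w).map (fun u => j :: u)
termination_by v w => v.length + w.length

/-- Shuffles of two words, with multiplicities. -/
def shuffleWords (v w : Word) : List Word := (shuffleRev v.reverse w.reverse).map List.reverse

/-- The shuffle product on `T((ℝ²))`: the bilinear extension of the shuffle product of words. -/
def shuffle (l p : TensorSeries) : TensorSeries := fun u =>
  ∑ᶠ v : Word, ∑ᶠ w : Word, l v * p w * ((shuffleWords v w).count u : ℝ)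

/-! ### The market -/

/-- The deterministic data: horizon `T`, drift `μ`, volatility `σ`, initial price `S₀`,
temporary impact `η`, permanent impact `ν`, risk aversion `lam`, initial inventory `X₀`,
and the payoff element `ξ ∈ T(ℝ²)`, which has finitely many nonzero coefficients. -/
structure Market where
  T : ℝ
  μ : ℝ
  σ : ℝ
  S₀ : ℝ
  η : ℝ
  ν : ℝ
  lam : ℝ
  X₀ : ℝ
  ξ : Word →₀ ℝ
  T_pos : 0 < T
  σ_nonneg : 0 ≤ σ
  η_nonneg : 0 ≤ η
  ν_nonneg : 0 ≤ ν
  lam_pos : 0 < lam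

/-- The time interval `[0, T]`. -/
abbrev Market.Time (M : Market) : Type := Set.Icc (0 : ℝ) M.T

/-- Lebesgue measure on `[0, T]`. -/
def Market.leb (M : Market) : Measure M.Time := Measure.comap Subtype.val volume

/-- The initial time. -/
def Market.start (M : Market) : M.Time := ⟨0, le_rfl, M.T_pos.le⟩

variable {Ω : Type*} {mΩ : MeasurableSpace Ω}

/-- The usual conditions: right-continuity, and all null sets belong to `ℱ₀`. -/
structure UsualConditions {M : Market} (P : Measure Ω) (ℱ : Filtration M.Time mΩ) : Prop where
  rightCont : ℱ.IsRightContinuous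
  complete : ∀ s : Set Ω, P s = 0 → MeasurableSet[ℱ M.start] s

/-- `W` is a standard Brownian motion on `[0, T]` relative to the filtration `ℱ`. -/
structure IsBrownianMotion {M : Market} (P : Measure Ω) (ℱ : Filtration M.Time mΩ)
    (W : M.Time → Ω → ℝ) : Prop where
  adapted : StronglyAdapted ℱ W
  start_zero : ∀ᵐ ω ∂P, W M.start ω = 0
  continuous : ∀ᵐ ω ∂P, Continuous fun t => W t ω
  increment_law : ∀ s t : M.Time, s ≤ t →
    P.map (W t - W s) = gaussianReal 0 (Real.toNNReal ((t : ℝ) - s))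
  increment_indep : ∀ s t : M.Time, s ≤ t →
    Indep (ℱ s) (MeasurableSpace.comap (W t - W s) inferInstance) P

/-! ### Stratonovich integrals and signatures -/

/-- `Z` is a continuous version of the Stratonovich integral process `t ↦ ∫ₛᵗ Y ∘ dX` on `[s, T]`:
it is almost surely continuous, and along every sequence of partitions
`s = π n 0 ≤ π n 1 ≤ ⋯ ≤ π n (N n) = t` whose mesh tends to zero, the trapezoidal sums converge
in probability to `Z t`. -/
def IsStratonovichIntegral {M : Market} (P : Measure Ω) (s : M.Time) (Y X Z : M.Time → Ω → ℝ) :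
    Prop :=
  (∀ᵐ ω ∂P, ContinuousOn (fun t => Z t ω) (Set.Ici s)) ∧
  ∀ t : M.Time, s ≤ t → ∀ (N : ℕ → ℕ) (π : ℕ → ℕ → M.Time),
    (∀ n, Monotone (π n)) → (∀ n, π n 0 = s) → (∀ n, π n (N n) = t) →
    (∀ δ : ℝ, 0 < δ → ∀ᶠ n in atTop, ∀ i < N n, (π n (i + 1) : ℝ) - π n i < δ) →
    TendstoInMeasure P
      (fun n ω => ∑ i ∈ Finset.range (N n),
        (Y (π n i) ω + Y (π n (i + 1)) ω) / 2 * (X (π n (i + 1)) ω - X (π n i) ω))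
      atTop (Z t)

open Classical in
/-- The Stratonovich integral process `t ↦ ∫ₛᵗ Y ∘ dX`, unique up to indistinguishability on
`[s, T]` (and zero by convention if the integral does not exist, which does not happen for
continuous semimartingales). -/
def stratonovichIntegral {M : Market} (P : Measure Ω) (s : M.Time) (Y X : M.Time → Ω → ℝ) :
    M.Time → Ω → ℝ :=
  if h : ∃ Z, IsStratonovichIntegral P s Y X Z then Classical.choose h else 0

/-- Iterated Stratonovich integrals from time `s`, for words written backwards:
`𝕏^{wi} = ∫ 𝕏^w ∘ dX^i` and `𝕏^∅ = 1`. -/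
def iteratedIntegralRev {M : Market} (P : Measure Ω) (s : M.Time)
    (X : Fin 2 → M.Time → Ω → ℝ) : Word → M.Time → Ω → ℝ
  | [] => fun _ _ => 1
  | i :: w => stratonovichIntegral P s (iteratedIntegralRev P s X w) (X i)

/-- The signature `𝕏_{s,t}` of the two-dimensional process `X` over `[s, t]`. -/
def signature {M : Market} (P : Measure Ω) (X : Fin 2 → M.Time → Ω → ℝ) (s t : M.Time) (ω : Ω) :
    TensorSeries :=
  fun w => iteratedIntegralRev P s X w.reverse t ω

namespace Market

variable (M : Market)

/-! ### The frictionless hedge of the payoff -/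

/-- The expected signature `𝓔_t = exp_⊗((1 + (σ²/2) 22) t)`. -/
def expectedSig (t : ℝ) : TensorSeries :=
  tensorExp (t • (basisWord [L1] + (M.σ ^ 2 / 2) • basisWord [L2, L2]))

/-- `ξ_t = ξ|_{𝓔_{T-t}}`. -/
def xi (t : M.Time) : TensorSeries := projSeries M.ξ (M.expectedSig (M.T - t))

/-- `ξ_t|_2`. -/
def xiDelta (t : M.Time) : TensorSeries := projWord (M.xi t) [L2]

/-- The truncation order `M̃` of `ξ_t|_2`: the least `N` with `ξ_t|_2 ∈ T^{≤ N}(ℝ²)` for all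
`t ∈ [0, T]`. -/
def truncOrder : ℕ := sInf {N : ℕ | ∀ t : M.Time, IsTruncatedAt N (M.xiDelta t)}

open Classical in
/-- The exponent `p = 2 ∨ 2 M̃ 1_{ν > 0}`. -/
def exponent : ℕ := max 2 (2 * M.truncOrder * (if 0 < M.ν then 1 else 0))

/-! ### Controls, inventory and impacted price -/

/-- The set `𝒜` of admissible trading speeds (the exponent is an even integer). -/
def admissible (P : Measure Ω) (ℱ : Filtration M.Time mΩ) : Set (M.Time → Ω → ℝ) :=
  {θ | IsStronglyProgressive ℱ θ ∧
    ∫⁻ ω, (∫⁻ t, ENNReal.ofReal (θ t ω ^ M.exponent) ∂M.leb) ∂P < ⊤}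

/-- The norm `‖θ‖_𝒜 = E(∫₀ᵀ θ_t^p dt)^{1/p}`. -/
def normA (P : Measure Ω) (θ : M.Time → Ω → ℝ) : ℝ :=
  (∫ ω, (∫ t, θ t ω ^ M.exponent ∂M.leb) ∂P) ^ (1 / (M.exponent : ℝ))

/-- The inventory `X^θ_t = X₀ + ∫₀ᵗ θ_s ds`. -/
def inventory (θ : M.Time → Ω → ℝ) (t : M.Time) (ω : Ω) : ℝ :=
  M.X₀ + ∫ s in Set.Iic t, θ s ω ∂M.leb

/-- The unaffected price `S_t = S₀ + μ t + σ W_t`. -/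
def basePrice (W : M.Time → Ω → ℝ) (t : M.Time) (ω : Ω) : ℝ :=
  M.S₀ + M.μ * t + M.σ * W t ω

/-- The impacted price `P^θ_t = S_t + ν (X^θ_t - X₀)`. -/
def price (W θ : M.Time → Ω → ℝ) (t : M.Time) (ω : Ω) : ℝ :=
  M.basePrice W t ω + M.ν * (M.inventory θ t ω - M.X₀)

/-- The signature over `[s, t]` of the time-augmented impacted price `(t, P^θ_t)`. -/
def priceSig (P : Measure Ω) (W θ : M.Time → Ω → ℝ) (s t : M.Time) (ω : Ω) : TensorSeries :=
  signature P ![fun u _ => (u : ℝ), M.price W θ] s t ω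

/-- `⟨ξ_t|_2, ℙ̂^θ_t⟩`. -/
def delta (P : Measure Ω) (W θ : M.Time → Ω → ℝ) (t : M.Time) (ω : Ω) : ℝ :=
  bracket (M.xiDelta t) (M.priceSig P W θ M.start t ω)

/-- `Γ^θ_{t,s} = ⟨ξ_s|_2, ℙ̂^θ_t ⊗ 2 ⊗ ℙ̂^θ_{t,s}⟩`. -/
def gam (P : Measure Ω) (W θ : M.Time → Ω → ℝ) (t s : M.Time) (ω : Ω) : ℝ :=
  bracket (M.xiDelta s)
    (tensorMul (M.priceSig P W θ M.start t ω)
      (tensorMul (basisWord [L2]) (M.priceSig P W θ t s ω)))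

/-- `Γ̃^θ_{t,s} = ⟨(ξ_s|_2)^{⧢ 2}, ℙ̂^θ_t ⊗ 2 ⊗ ℙ̂^θ_{t,s}⟩`. -/
def gamTilde (P : Measure Ω) (W θ : M.Time → Ω → ℝ) (t s : M.Time) (ω : Ω) : ℝ :=
  bracket (shuffle (M.xiDelta s) (M.xiDelta s))
    (tensorMul (M.priceSig P W θ M.start t ω)
      (tensorMul (basisWord [L2]) (M.priceSig P W θ t s ω)))

/-! ### The gain functional and its gradient operators -/

/-- The integrand of the gain functional. -/
def gainRate (P : Measure Ω) (W θ : M.Time → Ω → ℝ) (t : M.Time) (ω : Ω) : ℝ :=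
  (M.μ + M.ν * θ t ω) * (M.inventory θ t ω - M.delta P W θ t ω) - M.η * θ t ω ^ 2
    - M.lam / 2 * M.σ ^ 2 * (M.inventory θ t ω - M.delta P W θ t ω) ^ 2

/-- The gain functional `J`. -/
def gain (P : Measure Ω) (W θ : M.Time → Ω → ℝ) : ℝ :=
  ∫ ω, (∫ t, M.gainRate P W θ t ω ∂M.leb) ∂P

/-- The random variable `∫ₜᵀ E(Y_s | ℱ_t) ds`. As conditional expectations are only defined
almost surely for each single `s`, the integral is that of a version jointly measurable in
`(s, ω)`, i.e. it is the conditional expectation of `∫ₜᵀ Y_s ds`. -/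
def condFuture (P : Measure Ω) (ℱ : Filtration M.Time mΩ) (t : M.Time) (Y : M.Time → Ω → ℝ) :
    Ω → ℝ :=
  P[fun ω => ∫ s in Set.Ioi t, Y s ω ∂M.leb | ℱ t]

/-- The operator **A**. -/
def opA (P : Measure Ω) (ℱ : Filtration M.Time mΩ) (W θ : M.Time → Ω → ℝ) (t : M.Time) (ω : Ω) :
    ℝ :=
  M.inventory θ t ω - M.delta P W θ t ω
    + M.condFuture P ℱ t (fun s ω => θ s ω * (1 - M.ν * M.gam P W θ t s ω)) ω

/-- The operator **B**. -/
def opB (P : Measure Ω) (ℱ : Filtration M.Time mΩ) (W θ : M.Time → Ω → ℝ) (t : M.Time) (ω : Ω) :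
    ℝ :=
  M.condFuture P ℱ t (fun s ω => M.inventory θ s ω * (1 - M.ν * M.gam P W θ t s ω)) ω
    + M.condFuture P ℱ t
        (fun s ω => 1 / 2 * M.ν * M.gamTilde P W θ t s ω - M.delta P W θ s ω) ω

/-- The operator **C**. -/
def opC (P : Measure Ω) (ℱ : Filtration M.Time mΩ) (W θ : M.Time → Ω → ℝ) (t : M.Time) (ω : Ω) :
    ℝ :=
  (M.T - t) - M.condFuture P ℱ t (fun s ω => M.ν * M.gam P W θ t s ω) ω

/-- The process
`-2η θ + ε ‖θ‖_𝒜^{2-p} θ^{p-1} + ν A(θ) - λ σ² B(θ) + μ C(θ)`. -/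
def monotoneField (P : Measure Ω) (ℱ : Filtration M.Time mΩ) (W : M.Time → Ω → ℝ) (ε : ℝ)
    (θ : M.Time → Ω → ℝ) (t : M.Time) (ω : Ω) : ℝ :=
  -2 * M.η * θ t ω
    + ε * (M.normA P θ ^ (2 - (M.exponent : ℝ)) * θ t ω ^ (M.exponent - 1))
    + M.ν * M.opA P ℱ W θ t ω - M.lam * M.σ ^ 2 * M.opB P ℱ W θ t ω + M.μ * M.opC P ℱ W θ t ω

/-- The pairing `⟨f, g⟩_{L₂} = E ∫₀ᵀ f_t g_t dt`, computed as `∫₀ᵀ E(f_t g_t) dt`; in this order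
it does not depend on which versions of the random variables `f_t`, `g_t` are taken at each
time `t`. -/
def pairing (P : Measure Ω) (f g : M.Time → Ω → ℝ) : ℝ :=
  ∫ t, (∫ ω, f t ω * g t ω ∂P) ∂M.leb

/-- All integrals in `pairing` are absolutely convergent. -/
def PairingDefined (P : Measure Ω) (f g : M.Time → Ω → ℝ) : Prop :=
  (∀ᵐ t ∂M.leb, Integrable (fun ω => f t ω * g t ω) P) ∧
  Integrable (fun t => ∫ ω, f t ω * g t ω ∂P) M.leb

/-- The monotonicity condition with constant `ε`. -/
def MonotonicityCondition (P : Measure Ω) (ℱ : Filtration M.Time mΩ) (W : M.Time → Ω → ℝ)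
    (ε : ℝ) : Prop :=
  ∀ θ ∈ M.admissible P ℱ, ∀ φ ∈ M.admissible P ℱ,
    M.PairingDefined P (M.monotoneField P ℱ W ε θ - M.monotoneField P ℱ W ε φ) (θ - φ) ∧
    M.pairing P (M.monotoneField P ℱ W ε θ - M.monotoneField P ℱ W ε φ) (θ - φ) ≤ 0

/-- `θ` is an optimal control: it is admissible and maximizes `J` over `𝒜`. -/
def IsOptimal (P : Measure Ω) (ℱ : Filtration M.Time mΩ) (W θ : M.Time → Ω → ℝ) : Prop :=
  θ ∈ M.admissible P ℱ ∧ IsMaxOn (M.gain P W) (M.admissible P ℱ) θ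

end Market

end SigHedging

end

namespace SigHedging

/-! ### Coefficients of the frictionless hedge -/

theorem tensorPow_eq_zero {p : TensorSeries} (hp : p [] = 0) (k : ℕ) (w : Word)
    (hw : w.length < k) : tensorPow p k w = 0 := by
  induction k generalizing w with
  | zero => simp at hw
  | succ k ih =>
    rw [tensorPow, tensorMul]
    refine Finset.sum_eq_zero fun j hj => ?_
    rcases Nat.eq_zero_or_pos j with rfl | hj0
    · simp [hp]
    · rw [ih, mul_zero]
      rw [List.length_drop]
      have := Finset.mem_range.1 hj
      omega

theorem tensorPow_smul (t : ℝ) (p : TensorSeries) (k : ℕ) (w : Word) :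
    tensorPow (t • p) k w = t ^ k * tensorPow p k w := by
  induction k generalizing w with
  | zero => simp [tensorPow]
  | succ k ih =>
    simp only [tensorPow, tensorMul, ih, Finset.mul_sum, Pi.smul_apply, smul_eq_mul]
    refine Finset.sum_congr rfl fun j _ => ?_
    ring

theorem continuous_tensorExp_smul {p : TensorSeries} (hp : p [] = 0) (w : Word) :
    Continuous fun t : ℝ => tensorExp (t • p) w := by
  have h : (fun t : ℝ => tensorExp (t • p) w) = fun t : ℝ =>
      ∑ k ∈ Finset.range (w.length + 1), t ^ k * tensorPow p k w / (Nat.factorial k : ℝ) := by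
    funext t
    simp only [tensorExp, tensorPow_smul]
    refine tsum_eq_sum fun k hk => ?_
    rw [tensorPow_eq_zero hp k w (by simpa using hk)]
    simp
  rw [h]
  fun_prop

theorem projSeries_eq_sum (l : Word →₀ ℝ) (q : TensorSeries) (v : Word) :
    projSeries l q v =
      ∑ u ∈ l.support.preimage (fun u => v ++ u) (List.append_right_injective v).injOn,
        l (v ++ u) * q u := by
  refine finsum_eq_sum_of_support_subset _ fun u hu => ?_
  simp only [Function.mem_support] at hu
  simpa using left_ne_zero_of_mul hu

namespace Market

variable (M : Market)

theorem continuous_expectedSig (w : Word) : Continuous fun t => M.expectedSig t w :=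
  continuous_tensorExp_smul (by simp [basisWord]) w

theorem continuous_xi (w : Word) : Continuous fun t => M.xi t w := by
  simp only [xi, projSeries_eq_sum]
  refine continuous_finsetSum _ fun u _ => continuous_const.mul ?_
  exact (M.continuous_expectedSig u).comp (by fun_prop)

theorem exponent_eq_two (htrunc : ∀ t : M.Time, IsTruncatedAt 1 (M.xiDelta t)) :
    M.exponent = 2 := by
  have h : M.truncOrder ≤ 1 := Nat.sInf_le htrunc
  unfold exponent
  split_ifs <;> omega

end Market

/-! ### Brackets with elements of low order -/

theorem bracket_of_truncated_one {l : TensorSeries} (hl : IsTruncatedAt 1 l) (q : TensorSeries) :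
    bracket l q = l [] * q [] + l [L1] * q [L1] + l [L2] * q [L2] := by
  have h : bracket l q = ∑ w ∈ ({[], [L1], [L2]} : Finset Word), l w * q w := by
    refine finsum_eq_sum_of_support_subset _ fun w hw => ?_
    have hlw := left_ne_zero_of_mul (Function.mem_support.1 hw)
    match w with
    | [] => simp
    | [i] => fin_cases i <;> simp
    | i :: j :: v => exact absurd (hl _ (by simp)) hlw
  rw [h]
  simp [← add_assoc]

theorem shuffle_of_truncated_one {l : TensorSeries} (hl : IsTruncatedAt 1 l) (u : Word) :
    shuffle l l u = ∑ v ∈ ({[], [L1], [L2]} : Finset Word),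
      ∑ w ∈ ({[], [L1], [L2]} : Finset Word), l v * l w * ((shuffleWords v w).count u : ℝ) := by
  have key : ∀ v, v ∉ ({[], [L1], [L2]} : Finset Word) → l v = 0 := by
    intro w hw
    match w with
    | [] => simp at hw
    | [i] => fin_cases i <;> simp at hw
    | i :: j :: v => exact hl _ (by simp)
  unfold shuffle
  rw [finsum_eq_sum_of_support_subset _ (s := ({[], [L1], [L2]} : Finset Word))]
  · refine Finset.sum_congr rfl fun v _ => ?_
    refine finsum_eq_sum_of_support_subset _ fun w hw => ?_
    by_contra h
    exact hw (by simp [key w h])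
  · intro v hv
    by_contra h
    exact hv (by simp [key v h])

theorem bracket_shuffle_self {l : TensorSeries} (hl : IsTruncatedAt 1 l) (q : TensorSeries) :
    bracket (shuffle l l) q = l [] ^ 2 * q [] + 2 * l [] * (l [L1] * q [L1] + l [L2] * q [L2])
      + 2 * l [L1] ^ 2 * q [L1, L1] + 2 * l [L2] ^ 2 * q [L2, L2]
      + 2 * l [L1] * l [L2] * (q [L1, L2] + q [L2, L1]) := by
  have h : bracket (shuffle l l) q = ∑ w ∈ ({[], [L1], [L2], [L1, L1], [L1, L2], [L2, L1],
      [L2, L2]} : Finset Word), shuffle l l w * q w := by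
    refine finsum_eq_sum_of_support_subset _ fun w hw => ?_
    have hlw := left_ne_zero_of_mul (Function.mem_support.1 hw)
    match w with
    | [] => simp
    | [i] => fin_cases i <;> simp
    | [i, j] => fin_cases i <;> fin_cases j <;> simp
    | i :: j :: k :: v =>
      refine absurd ?_ hlw
      rw [shuffle_of_truncated_one hl]
      simp [shuffleWords, shuffleRev]
  rw [h]
  simp [shuffle_of_truncated_one hl, shuffleWords, shuffleRev, List.count_cons]
  ring

theorem tensorMul_letter_two {p q : TensorSeries} (hp : p [] = 1) (hq : q [] = 1) :
    tensorMul p (tensorMul (basisWord [L2]) q) [] = 0 ∧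
    tensorMul p (tensorMul (basisWord [L2]) q) [L1] = 0 ∧
    tensorMul p (tensorMul (basisWord [L2]) q) [L2] = 1 ∧
    tensorMul p (tensorMul (basisWord [L2]) q) [L1, L1] = 0 ∧
    tensorMul p (tensorMul (basisWord [L2]) q) [L1, L2] = p [L1] ∧
    tensorMul p (tensorMul (basisWord [L2]) q) [L2, L1] = q [L1] ∧
    tensorMul p (tensorMul (basisWord [L2]) q) [L2, L2] = p [L2] + q [L2] := by
  refine ⟨?_, ?_, ?_, ?_, ?_, ?_, ?_⟩ <;>
    simp [tensorMul, Finset.sum_range_succ, basisWord, Pi.single_apply, hp, hq, add_comm]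

/-! ### Signatures of the first order -/

/-- The uniform partition of `[s, t]` into `n` intervals. -/
noncomputable def uniformPartition {M : Market} (s t : M.Time) (n i : ℕ) : M.Time :=
  if h : i ≤ n ∧ 0 < n ∧ s ≤ t then
    ⟨s + (t - s) * (i / n), by
      obtain ⟨h1, h2, h3⟩ := h
      have h3' : (s : ℝ) ≤ t := h3
      have : (i : ℝ) / n ≤ 1 := by
        rw [div_le_one (by exact_mod_cast h2)]
        exact_mod_cast h1
      have h0 : (0 : ℝ) ≤ (i : ℝ) / n := by positivity
      have hs := s.2.1
      have ht := t.2.2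
      constructor <;> nlinarith⟩
  else t

theorem exists_partition {M : Market} {s t : M.Time} (hst : s ≤ t) :
    ∃ (N : ℕ → ℕ) (π : ℕ → ℕ → M.Time),
    (∀ n, Monotone (π n)) ∧ (∀ n, π n 0 = s) ∧ (∀ n, π n (N n) = t) ∧
    (∀ δ : ℝ, 0 < δ → ∀ᶠ n in atTop, ∀ i < N n, (π n (i + 1) : ℝ) - π n i < δ) := by
  have hst' : (s : ℝ) ≤ t := hst
  have val : ∀ n i : ℕ, i ≤ n + 1 →
      (uniformPartition s t (n + 1) i : ℝ) = s + (t - s) * (i / (n + 1 : ℕ)) := by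
    intro n i hi
    simp [uniformPartition, hi, hst]
  refine ⟨fun n => n + 1, fun n => uniformPartition s t (n + 1), ?_, ?_, ?_, ?_⟩
  · refine fun n => monotone_nat_of_le_succ fun i => ?_
    beta_reduce
    by_cases hi : i + 1 ≤ n + 1
    · rw [← Subtype.coe_le_coe, val n i (by omega), val n (i + 1) hi]
      gcongr
      linarith
    · have : uniformPartition s t (n + 1) (i + 1) = t := by simp [uniformPartition]; omega
      rw [this]
      by_cases hi : i ≤ n + 1
      · rw [← Subtype.coe_le_coe, val n i hi]
        have : (i : ℝ) / (n + 1 : ℕ) ≤ 1 := by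
          rw [div_le_one (by positivity)]
          exact_mod_cast hi
        nlinarith
      · simp only [uniformPartition, hi, false_and, dite_false, le_refl]
  · intro n
    apply Subtype.ext
    simp [val]
  · intro n
    apply Subtype.ext
    rw [val _ _ le_rfl, div_self (by positivity)]
    ring
  · intro δ hδ
    obtain ⟨k, hk⟩ := exists_nat_gt ((t - s : ℝ) / δ)
    filter_upwards [eventually_ge_atTop k] with n hn i hi
    rw [val n i (by omega), val n (i + 1) (by omega)]
    have hn' : (k : ℝ) ≤ n := by exact_mod_cast hn
    have h1 : (t - s : ℝ) < δ * (n + 1 : ℕ) := by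
      rw [div_lt_iff₀ hδ] at hk
      push_cast
      nlinarith
    have h2 : (s + (t - s) * (((i + 1 : ℕ) : ℝ) / (n + 1 : ℕ))
        - (s + (t - s) * ((i : ℝ) / (n + 1 : ℕ))) : ℝ) = (t - s) / (n + 1 : ℕ) := by
      push_cast
      ring
    rw [h2, div_lt_iff₀ (by positivity)]
    exact h1

variable {Ω : Type*} {mΩ : MeasurableSpace Ω} {P : Measure Ω}

theorem isStratonovichIntegral_one {M : Market} (s : M.Time) {X : M.Time → Ω → ℝ}
    (hX : ∀ᵐ ω ∂P, Continuous fun t => X t ω) :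
    IsStratonovichIntegral P s (fun _ _ => 1) X (fun t ω => X t ω - X s ω) := by
  refine ⟨?_, ?_⟩
  · filter_upwards [hX] with ω hω
    exact (hω.sub continuous_const).continuousOn
  · intro t _ N π _ h0 hN _
    have : (fun (n : ℕ) ω => ∑ i ∈ Finset.range (N n),
        ((1 : ℝ) + 1) / 2 * (X (π n (i + 1)) ω - X (π n i) ω)) =
        fun _ ω => X t ω - X s ω := by
      funext n ω
      have := Finset.sum_range_sub (fun i => X (π n i) ω) (N n)
      simp only [h0, hN] at this
      rw [← this]
      exact Finset.sum_congr rfl fun i _ => by ring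
    rw [this]
    intro e he
    simp [he.ne']

theorem IsStratonovichIntegral.ae_eq {M : Market} {s : M.Time} {Y X Z Z' : M.Time → Ω → ℝ}
    (h : IsStratonovichIntegral P s Y X Z) (h' : IsStratonovichIntegral P s Y X Z') :
    ∀ᵐ ω ∂P, ∀ t, s ≤ t → Z t ω = Z' t ω := by
  have point : ∀ t, s ≤ t → Z t =ᵐ[P] Z' t := by
    intro t ht
    obtain ⟨N, π, h1, h2, h3, h4⟩ := exists_partition ht
    exact tendstoInMeasure_ae_unique (h.2 t ht N π h1 h2 h3 h4) (h'.2 t ht N π h1 h2 h3 h4)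
  obtain ⟨D, hDc, hD⟩ := TopologicalSpace.exists_countable_dense (Set.Ici s)
  have hall : ∀ᵐ ω ∂P, ∀ t ∈ D, Z t ω = Z' t ω :=
    (ae_ball_iff hDc).2 fun t _ => point t t.2
  filter_upwards [hall, h.1, h'.1] with ω hω c c' t ht
  have := Continuous.ext_on hD (continuousOn_iff_continuous_domRestrict.1 c)
    (continuousOn_iff_continuous_domRestrict.1 c') (fun t ht => hω t ht)
  exact congrFun this ⟨t, ht⟩

theorem ae_stratonovichIntegral_one {M : Market} (s : M.Time) {X : M.Time → Ω → ℝ}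
    (hX : ∀ᵐ ω ∂P, Continuous fun t => X t ω) :
    ∀ᵐ ω ∂P, ∀ t, s ≤ t →
      stratonovichIntegral P s (fun _ _ => 1) X t ω = X t ω - X s ω := by
  have h : ∃ Z, IsStratonovichIntegral P s (fun _ _ => 1) X Z :=
    ⟨_, isStratonovichIntegral_one s hX⟩
  have hz := Classical.choose_spec h
  rw [stratonovichIntegral, dif_pos h]
  exact hz.ae_eq (isStratonovichIntegral_one s hX)

theorem signature_nil {M : Market} (X : Fin 2 → M.Time → Ω → ℝ) (s t : M.Time) (ω : Ω) :
    signature P X s t ω [] = 1 := by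
  simp [signature, iteratedIntegralRev]

theorem ae_signature_letter {M : Market} {X : Fin 2 → M.Time → Ω → ℝ} (s : M.Time) (i : Fin 2)
    (hX : ∀ᵐ ω ∂P, Continuous fun t => X i t ω) :
    ∀ᵐ ω ∂P, ∀ t, s ≤ t → signature P X s t ω [i] = X i t ω - X i s ω :=
  ae_stratonovichIntegral_one s hX

end SigHedging

namespace SigHedging

/-! ### Integrals over past and future times -/

section TimeIntegral

theorem integrable_mul_of_memLp_two {α : Type*} [MeasurableSpace α] {μ : Measure α} {f g : α → ℝ}
    (hf : MemLp f 2 μ) (hg : MemLp g 2 μ) : Integrable (fun z => f z * g z) μ :=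
  hf.integrable_mul hg

variable {τ Ω : Type*} [MeasurableSpace τ] [MeasurableSpace Ω]

/-- The integral of `s ↦ f (s, ω)` over the set `A t` of times. -/
noncomputable def timeInt (m : Measure τ) (A : τ → Set τ) (f : τ × Ω → ℝ) (z : τ × Ω) : ℝ :=
  ∫ s in A z.1, f (s, z.2) ∂m

variable {m : Measure τ} {P : Measure Ω} {A : τ → Set τ}

theorem measurableSet_section (hA : MeasurableSet {p : τ × τ | p.2 ∈ A p.1}) (t : τ) :
    MeasurableSet (A t) :=
  measurable_prodMk_left hA

theorem StronglyMeasurable.timeInt [SFinite m] (hA : MeasurableSet {p : τ × τ | p.2 ∈ A p.1})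
    {f : τ × Ω → ℝ} (hf : StronglyMeasurable f) : StronglyMeasurable (timeInt m A f) := by
  have h : SigHedging.timeInt m A f = fun z : τ × Ω => ∫ s, Set.indicator
      {p : (τ × Ω) × τ | p.2 ∈ A p.1.1} (fun p => f (p.2, p.1.2)) (z, s) ∂m := by
    funext z
    rw [SigHedging.timeInt, ← integral_indicator (measurableSet_section hA z.1)]
    rfl
  rw [h]
  refine StronglyMeasurable.integral_prod_right' (StronglyMeasurable.indicator ?_ ?_)
  · exact hf.comp_measurable (by fun_prop)
  · exact (show Measurable fun p : (τ × Ω) × τ => (p.1.1, p.2) by fun_prop) hA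

theorem timeInt_congr_ae [SFinite m] [SFinite P] {f g : τ × Ω → ℝ} (h : f =ᵐ[m.prod P] g) :
    ∀ᵐ ω ∂P, ∀ t, timeInt m A f (t, ω) = timeInt m A g (t, ω) := by
  have h' : ∀ᵐ z ∂(P.prod m), f z.swap = g z.swap :=
    (Measure.measurePreserving_swap (μ := P) (ν := m)).quasiMeasurePreserving.ae h
  filter_upwards [Measure.ae_ae_of_ae_prod h'] with ω hω t
  exact integral_congr_ae (ae_restrict_of_ae hω)

theorem timeInt_ae_eq [SFinite m] [SFinite P] {f g : τ × Ω → ℝ} (h : f =ᵐ[m.prod P] g) :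
    timeInt m A f =ᵐ[m.prod P] timeInt m A g := by
  have h1 : ∀ᵐ z : τ × Ω ∂(m.prod P), ∀ t, timeInt m A f (t, z.2) = timeInt m A g (t, z.2) :=
    Measure.quasiMeasurePreserving_snd.ae (timeInt_congr_ae h)
  filter_upwards [h1] with z hz
  exact hz z.1

theorem AEStronglyMeasurable.timeInt [SFinite m] [SFinite P]
    (hA : MeasurableSet {p : τ × τ | p.2 ∈ A p.1}) {f : τ × Ω → ℝ}
    (hf : AEStronglyMeasurable f (m.prod P)) :
    AEStronglyMeasurable (timeInt m A f) (m.prod P) :=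
  ⟨_, StronglyMeasurable.timeInt hA hf.stronglyMeasurable_mk, timeInt_ae_eq hf.ae_eq_mk⟩

theorem sq_lintegral_le {g : τ → ENNReal} (hg : AEMeasurable g m) :
    (∫⁻ s, g s ∂m) ^ 2 ≤ m Set.univ * ∫⁻ s, g s ^ 2 ∂m := by
  have h := ENNReal.lintegral_mul_le_Lp_mul_Lq m Real.HolderConjugate.two_two
    (f := fun _ => 1) (g := g) aemeasurable_const hg
  simp only [Pi.mul_apply, one_mul, ENNReal.one_rpow, lintegral_const, one_div] at h
  calc (∫⁻ s, g s ∂m) ^ 2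
      ≤ (m Set.univ ^ (2 : ℝ)⁻¹ * (∫⁻ s, g s ^ (2 : ℝ) ∂m) ^ (2 : ℝ)⁻¹) ^ 2 := by gcongr
    _ = _ := by
      rw [mul_pow, ← ENNReal.rpow_natCast, ← ENNReal.rpow_natCast, ← ENNReal.rpow_mul,
        ← ENNReal.rpow_mul]
      norm_num

theorem lintegral_timeInt_sq_le [IsFiniteMeasure m] [SFinite P]
    {f : τ × Ω → ℝ} (hf : AEStronglyMeasurable f (m.prod P)) :
    ∫⁻ z, ‖timeInt m A f z‖ₑ ^ 2 ∂(m.prod P) ≤ m Set.univ ^ 2 * ∫⁻ z, ‖f z‖ₑ ^ 2 ∂(m.prod P) := by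
  have hsw : AEStronglyMeasurable (fun z : Ω × τ => f z.swap) (P.prod m) := hf.prod_swap
  have h1 : ∀ᵐ ω ∂P, ∀ t, ‖timeInt m A f (t, ω)‖ₑ ^ 2
      ≤ m Set.univ * ∫⁻ s, ‖f (s, ω)‖ₑ ^ 2 ∂m := by
    filter_upwards [hsw.prodMk_left] with ω hω t
    have hω' : AEStronglyMeasurable (fun s => f (s, ω)) m := hω
    refine le_trans ?_ (sq_lintegral_le hω'.enorm)
    gcongr
    exact (enorm_integral_le_lintegral_enorm _).trans
      (lintegral_mono' Measure.restrict_le_self le_rfl)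
  have h2 : ∀ᵐ z : τ × Ω ∂(m.prod P), ‖timeInt m A f z‖ₑ ^ 2
      ≤ m Set.univ * ∫⁻ s, ‖f (s, z.2)‖ₑ ^ 2 ∂m := by
    filter_upwards [Measure.quasiMeasurePreserving_snd.ae h1] with z hz
    exact hz z.1
  have hm : AEMeasurable (fun z => ‖f z‖ₑ ^ 2) (m.prod P) := hf.enorm.pow_const 2
  have hm' : AEMeasurable (fun ω => ∫⁻ s, ‖f (s, ω)‖ₑ ^ 2 ∂m) P := by
    have : AEMeasurable (fun z : Ω × τ => ‖f z.swap‖ₑ ^ 2) (P.prod m) := hsw.enorm.pow_const 2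
    exact this.lintegral_prod_right'
  calc ∫⁻ z, ‖timeInt m A f z‖ₑ ^ 2 ∂(m.prod P)
      ≤ ∫⁻ z : τ × Ω, m Set.univ * ∫⁻ s, ‖f (s, z.2)‖ₑ ^ 2 ∂m ∂(m.prod P) := lintegral_mono_ae h2
    _ = m Set.univ * ∫⁻ z : τ × Ω, ∫⁻ s, ‖f (s, z.2)‖ₑ ^ 2 ∂m ∂(m.prod P) :=
      lintegral_const_mul' _ _ (measure_ne_top _ _)
    _ = m Set.univ * (m Set.univ * ∫⁻ z, ‖f z‖ₑ ^ 2 ∂(m.prod P)) := by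
      congr 1
      have h3 : AEMeasurable (fun z : τ × Ω => ∫⁻ s, ‖f (s, z.2)‖ₑ ^ 2 ∂m) (m.prod P) :=
        hm'.comp_quasiMeasurePreserving Measure.quasiMeasurePreserving_snd
      rw [lintegral_prod_symm _ hm, lintegral_prod _ h3]
      simp [mul_comm]
    _ = _ := by ring

theorem eLpNorm_timeInt_le [IsFiniteMeasure m] [SFinite P]
    {f : τ × Ω → ℝ} (hf : AEStronglyMeasurable f (m.prod P)) :
    eLpNorm (timeInt m A f) 2 (m.prod P) ≤ m Set.univ * eLpNorm f 2 (m.prod P) := by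
  have key : ∀ g : τ × Ω → ℝ, eLpNorm g 2 (m.prod P) ^ 2 = ∫⁻ z, ‖g z‖ₑ ^ 2 ∂(m.prod P) := by
    intro g
    have := eLpNorm_nnreal_pow_eq_lintegral (f := g) (μ := m.prod P) (p := 2) (by simp)
    simpa using this
  rw [← ENNReal.pow_le_pow_left_iff two_ne_zero, mul_pow, key, key]
  exact lintegral_timeInt_sq_le hf

theorem MemLp.timeInt [IsFiniteMeasure m] [SFinite P]
    (hA : MeasurableSet {p : τ × τ | p.2 ∈ A p.1}) {f : τ × Ω → ℝ} (hf : MemLp f 2 (m.prod P)) :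
    MemLp (timeInt m A f) 2 (m.prod P) :=
  ⟨AEStronglyMeasurable.timeInt hA hf.1, (eLpNorm_timeInt_le hf.1).trans_lt
    (ENNReal.mul_lt_top (measure_lt_top _ _) hf.2)⟩

theorem ae_memLp_slice [SFinite m] [SFinite P] {f : τ × Ω → ℝ} (hf : MemLp f 2 (m.prod P)) :
    ∀ᵐ ω ∂P, MemLp (fun t => f (t, ω)) 2 m := by
  have h1 : AEStronglyMeasurable (fun z : Ω × τ => f z.swap) (P.prod m) := hf.1.prod_swap
  have h2 := hf.integrable_sq.prod_left_ae
  filter_upwards [h1.prodMk_left, h2] with ω h1 h2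
  exact (memLp_two_iff_integrable_sq h1).2 h2

theorem sq_integral_le [IsFiniteMeasure m] {u : τ → ℝ} (hu : MemLp u 2 m) :
    (∫ t, u t ∂m) ^ 2 ≤ m.real Set.univ * ∫ t, u t ^ 2 ∂m := by
  set c := m.real Set.univ with hc
  set I := ∫ t, u t ∂m with hI
  have hu1 : Integrable u m := hu.integrable (by norm_num)
  have hu2 := hu.integrable_sq
  have h0 : 0 ≤ ∫ t, (c * u t - I) ^ 2 ∂m := integral_nonneg fun t => sq_nonneg _
  have h1 : ∫ t, (c * u t - I) ^ 2 ∂m = c * (c * ∫ t, u t ^ 2 ∂m - I ^ 2) := by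
    have : ∀ t, (c * u t - I) ^ 2 = c ^ 2 * u t ^ 2 - 2 * c * I * u t + I ^ 2 := fun t => by ring
    simp only [this]
    have hs : Integrable (fun t => c ^ 2 * u t ^ 2 - 2 * c * I * u t) m :=
      (hu2.const_mul _).sub (hu1.const_mul _)
    rw [integral_add hs (integrable_const _), integral_sub (hu2.const_mul _) (hu1.const_mul _),
      integral_const_mul, integral_const_mul,
      integral_const, ← hI, ← hc, smul_eq_mul]
    ring
  rcases (measureReal_nonneg (μ := m) (s := Set.univ)).eq_or_lt with h | h
  · have hm : m = 0 := by
      rw [eq_comm, measureReal_eq_zero_iff, Measure.measure_univ_eq_zero] at h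
      exact h
    simp [hI, hm]
  · rw [h1] at h0
    have := nonneg_of_mul_nonneg_right h0 h
    linarith

theorem integrable_mul_setIntegral [IsFiniteMeasure m]
    (hA : MeasurableSet {p : τ × τ | p.2 ∈ A p.1}) {u : τ → ℝ} (hu1 : Integrable u m) :
    Integrable (fun t => u t * ∫ s in A t, u s ∂m) m := by
  have h : StronglyMeasurable (fun t => ∫ s in A t, hu1.1.mk u s ∂m) := by
    have := (StronglyMeasurable.timeInt (Ω := Unit) (m := m) hA (f := fun p => hu1.1.mk u p.1)
      (hu1.1.stronglyMeasurable_mk.comp_measurable measurable_fst))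
    exact this.comp_measurable (g := fun t => (t, ())) (by fun_prop)
  refine hu1.mul_bdd (c := ∫ s, |u s| ∂m) ⟨_, h, ?_⟩ ?_
  · refine Eventually.of_forall fun t => ?_
    exact integral_congr_ae (ae_restrict_of_ae hu1.1.ae_eq_mk)
  · refine Eventually.of_forall fun t => (norm_integral_le_integral_norm _).trans ?_
    exact setIntegral_le_integral hu1.norm (Eventually.of_forall fun s => norm_nonneg _)

end TimeIntegral

section Past

variable {τ Ω : Type*} [MeasurableSpace τ] [MeasurableSpace Ω] [LinearOrder τ]
  [TopologicalSpace τ] [OrderClosedTopology τ] [SecondCountableTopology τ] [BorelSpace τ]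
  {m : Measure τ} {P : Measure Ω}

theorem measurableSet_past : MeasurableSet {p : τ × τ | p.2 ∈ Set.Iic p.1} :=
  measurableSet_le measurable_snd measurable_fst

theorem measurableSet_future : MeasurableSet {p : τ × τ | p.2 ∈ Set.Ioi p.1} :=
  measurableSet_lt measurable_fst measurable_snd

theorem integral_past_mul [IsFiniteMeasure m] [NullSingletonClass m]
    {u q : τ → ℝ} (hu : Integrable u m)
    (hq : Integrable q m) :
    ∫ t, (∫ s in Set.Iic t, u s ∂m) * q t ∂m = ∫ t, u t * ∫ s in Set.Ioi t, q s ∂m ∂m := by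
  set F : τ × τ → ℝ := Set.indicator {p : τ × τ | p.2 ∈ Set.Iic p.1} (fun p => q p.1 * u p.2)
  have hF : Integrable F (m.prod m) := (hq.mul_prod hu).indicator measurableSet_past
  have h := integral_integral_swap (f := fun t s => F (t, s)) hF
  convert! h using 1
  · refine integral_congr_ae (Eventually.of_forall fun t => ?_)
    beta_reduce
    rw [mul_comm, ← integral_const_mul, ← integral_indicator measurableSet_Iic]
    rfl
  · refine integral_congr_ae (Eventually.of_forall fun s => ?_)
    beta_reduce
    rw [← integral_Ici_eq_integral_Ioi, ← integral_const_mul,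
      ← integral_indicator measurableSet_Ici]
    refine integral_congr_ae (Eventually.of_forall fun t => ?_)
    by_cases hst : s ≤ t <;> simp [F, Set.indicator, hst, mul_comm]

theorem integral_mul_past_le [IsFiniteMeasure m] [NullSingletonClass m]
    {u : τ → ℝ} (hu : MemLp u 2 m) :
    ∫ t, u t * ∫ s in Set.Iic t, u s ∂m ∂m ≤ m.real Set.univ / 2 * ∫ t, u t ^ 2 ∂m := by
  have hu1 : Integrable u m := hu.integrable (by norm_num)
  have hi := fun A hA => integrable_mul_setIntegral (A := A) hA hu1
  have h1 := integral_past_mul hu1 hu1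
  have h2 : (∫ t, u t * ∫ s in Set.Iic t, u s ∂m ∂m) + ∫ t, u t * ∫ s in Set.Ioi t, u s ∂m ∂m
      = (∫ t, u t ∂m) ^ 2 := by
    rw [← integral_add (hi _ measurableSet_past) (hi _ measurableSet_future), sq,
      ← integral_mul_const]
    refine integral_congr_ae (Eventually.of_forall fun t => ?_)
    beta_reduce
    rw [← mul_add, ← integral_add_compl (measurableSet_Iic (a := t)) hu1, Set.compl_Iic]
  have h3 := sq_integral_le hu
  simp only [mul_comm (∫ s in Set.Iic _, u s ∂m)] at h1
  linarith

theorem integral_timeInt_past_mul [IsFiniteMeasure m] [NullSingletonClass m]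
    [SFinite P] {f q : τ × Ω → ℝ}
    (hf : MemLp f 2 (m.prod P)) (hq : MemLp q 2 (m.prod P)) :
    ∫ z, timeInt m Set.Iic f z * q z ∂(m.prod P) =
      ∫ z, f z * timeInt m Set.Ioi q z ∂(m.prod P) := by
  rw [integral_prod_symm _ (integrable_mul_of_memLp_two (MemLp.timeInt measurableSet_past hf) hq),
    integral_prod_symm _ (integrable_mul_of_memLp_two hf (MemLp.timeInt measurableSet_future hq))]
  refine integral_congr_ae ?_
  filter_upwards [ae_memLp_slice hf, ae_memLp_slice hq] with ω h1 h2
  exact integral_past_mul (h1.integrable (by norm_num)) (h2.integrable (by norm_num))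

theorem integral_mul_timeInt_past_le [IsFiniteMeasure m] [NullSingletonClass m]
    [SFinite P] {g : τ → ℝ}
    {κ : ℝ} (hgm : Measurable g) (hg0 : ∀ t, 0 ≤ g t) (hgκ : ∀ t, g t ≤ κ) {f : τ × Ω → ℝ}
    (hf : MemLp f 2 (m.prod P)) :
    ∫ z, f z * (g z.1 * timeInt m Set.Iic f z) ∂(m.prod P)
      ≤ κ * (m.real Set.univ / 2) * ∫ z, f z ^ 2 ∂(m.prod P) := by
  have hV := MemLp.timeInt measurableSet_past hf
  have hgV : MemLp (fun z => g z.1 * timeInt m Set.Iic f z) 2 (m.prod P) := by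
    refine hV.of_le_mul (c := κ) ((hgm.comp measurable_fst).aestronglyMeasurable.mul hV.1)
      (Eventually.of_forall fun z => ?_)
    rw [norm_mul, Real.norm_of_nonneg (hg0 _)]
    gcongr
    exact hgκ _
  rw [integral_prod_symm _ (integrable_mul_of_memLp_two hf hgV),
    integral_prod_symm _ hf.integrable_sq,
    ← integral_const_mul]
  refine integral_mono_ae (integrable_mul_of_memLp_two hf hgV).integral_prod_right
    (hf.integrable_sq.integral_prod_right.const_mul _) ?_
  filter_upwards [ae_memLp_slice hf, (integrable_mul_of_memLp_two hf hgV).prod_left_ae] with ω h1 h2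
  have h3 := integral_mul_past_le (show MemLp (fun t => |f (t, ω)|) 2 m from h1.abs)
  by_cases hτ : Nonempty τ
  swap
  · rw [not_nonempty_iff] at hτ
    simp [Measure.eq_zero_of_isEmpty m]
  obtain ⟨t0⟩ := hτ
  have hκ : 0 ≤ κ := (hg0 t0).trans (hgκ t0)
  simp only [sq_abs] at h3
  have hint : Integrable (fun t => |f (t, ω)| * ∫ s in Set.Iic t, |f (s, ω)| ∂m) m :=
    integrable_mul_setIntegral measurableSet_past (h1.integrable (by norm_num)).abs
  calc ∫ t, f (t, ω) * (g t * timeInt m Set.Iic f (t, ω)) ∂m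
      ≤ ∫ t, κ * (|f (t, ω)| * ∫ s in Set.Iic t, |f (s, ω)| ∂m) ∂m := by
        refine integral_mono h2 (hint.const_mul _) fun t => ?_
        refine (le_abs_self _).trans ?_
        rw [abs_mul, abs_mul, abs_of_nonneg (hg0 t), mul_left_comm]
        refine mul_le_mul (hgκ t) ?_ (by positivity) hκ
        gcongr
        exact abs_integral_le_integral_abs
    _ ≤ κ * (m.real Set.univ / 2 * ∫ t, f (t, ω) ^ 2 ∂m) := by
        rw [integral_const_mul]
        gcongr
    _ = _ := by ring

end Past

end SigHedging

namespace SigHedging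

/-! ### The impacted price and the frictionless hedge along admissible controls -/

theorem continuous_setIntegral_Iic {τ : Type*} [MeasurableSpace τ] [LinearOrder τ]
    [TopologicalSpace τ] [OrderTopology τ] [SecondCountableTopology τ] [BorelSpace τ]
    {m : Measure τ} [NullSingletonClass m] {u : τ → ℝ} (hu : Integrable u m) :
    Continuous fun t => ∫ s in Set.Iic t, u s ∂m := by
  simp only [← integral_indicator measurableSet_Iic]
  refine continuous_iff_continuousAt.2 fun t => ?_
  refine continuousAt_of_dominated (bound := fun s => ‖u s‖) ?_ ?_ hu.norm ?_
  · exact Eventually.of_forall fun x => hu.1.indicator measurableSet_Iic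
  · exact Eventually.of_forall fun x => Eventually.of_forall fun s =>
      norm_indicator_le_norm_self _ _
  · have hne : ∀ᵐ s ∂m, s ≠ t := by simp [ae_iff]
    filter_upwards [hne] with s hs
    rcases lt_or_gt_of_ne hs with h | h
    · refine (continuousAt_const (y := u s)).congr ?_
      filter_upwards [lt_mem_nhds h] with x hx
      simp [hx.le]
    · refine (continuousAt_const (y := 0)).congr ?_
      filter_upwards [gt_mem_nhds h] with x hx
      simp [hx]

namespace Market

variable (M : Market)

theorem leb_apply {s : Set M.Time} (hs : MeasurableSet s) :
    M.leb s = volume ((Subtype.val : M.Time → ℝ) '' s) :=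
  Measure.comap_apply _ Subtype.val_injective
    (fun _ h => (MeasurableEmbedding.subtype_coe measurableSet_Icc).measurableSet_image.2 h) _ hs

theorem leb_univ : M.leb Set.univ = ENNReal.ofReal M.T := by
  rw [M.leb_apply MeasurableSet.univ, Set.image_univ, Subtype.range_coe, Real.volume_Icc, sub_zero]

instance : IsFiniteMeasure M.leb := ⟨by simp [M.leb_univ]⟩

instance : NullSingletonClass M.leb where
  measure_singleton t := by
    rw [M.leb_apply (measurableSet_singleton t)]
    simp

theorem leb_real_univ : M.leb.real Set.univ = M.T := by
  simp [Measure.real, M.leb_univ, M.T_pos.le]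

theorem start_le (t : M.Time) : M.start ≤ t := t.2.1

/-- The fraction `1 - ν ξ_t^{22}` of an inventory that is not offset by its impact on the hedge. -/
noncomputable def slack (t : M.Time) : ℝ := 1 - M.ν * M.xi t [L2, L2]

theorem continuous_slack : Continuous M.slack :=
  continuous_const.sub (continuous_const.mul (M.continuous_xi _))

variable {Ω : Type*} {mΩ : MeasurableSpace Ω} {P : Measure Ω} {W θ φ : M.Time → Ω → ℝ}

/-- The cumulated trades `X^θ_t - X₀`. -/
noncomputable abbrev trades (θ : M.Time → Ω → ℝ) : M.Time × Ω → ℝ :=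
  timeInt M.leb Set.Iic (Function.uncurry θ)

/-- The frictionless hedge of the unaffected price. -/
noncomputable def baseHedge (W : M.Time → Ω → ℝ) (z : M.Time × Ω) : ℝ :=
  M.xi z.1 [L2] + M.xi z.1 [L1, L2] * z.1
    + M.xi z.1 [L2, L2] * (M.μ * z.1 + M.σ * (W z.1 z.2 - W M.start z.2))

/-- The frictionless hedge of the impacted price, for a hedge of first order. -/
noncomputable def affineHedge (W θ : M.Time → Ω → ℝ) (z : M.Time × Ω) : ℝ :=
  M.baseHedge W z + M.ν * M.xi z.1 [L2, L2] * M.trades θ z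

theorem price_sub_start (t : M.Time) (ω : Ω) : M.price W θ t ω - M.price W θ M.start ω =
    M.μ * t + M.σ * (W t ω - W M.start ω) + M.ν * M.trades θ (t, ω) := by
  have h : Set.Iic M.start = {M.start} := by
    ext t
    exact ⟨fun h => le_antisymm h (M.start_le t), fun h => le_of_eq h⟩
  have h0 : ∫ s in Set.Iic M.start, θ s ω ∂M.leb = 0 := by
    rw [h, Measure.restrict_singleton]
    simp
  simp only [price, basePrice, inventory, h0]
  simp [timeInt, start, Function.uncurry]
  ring

variable {M}

theorem ae_continuous_price (hW : ∀ᵐ ω ∂P, Continuous fun t => W t ω)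
    (hθ : ∀ᵐ ω ∂P, Integrable (fun t => θ t ω) M.leb) :
    ∀ᵐ ω ∂P, Continuous fun t => M.price W θ t ω := by
  filter_upwards [hW, hθ] with ω h1 h2
  have := continuous_setIntegral_Iic h2
  unfold price basePrice inventory
  fun_prop

theorem ae_delta_eq (htrunc : ∀ t : M.Time, IsTruncatedAt 1 (M.xiDelta t))
    (hP : ∀ᵐ ω ∂P, Continuous fun t => M.price W θ t ω) :
    ∀ᵐ ω ∂P, ∀ t, M.delta P W θ t ω = M.affineHedge W θ (t, ω) := by
  have h1 := ae_signature_letter (P := P) (X := ![fun u _ => (u : ℝ), M.price W θ]) M.start L1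
    (Eventually.of_forall fun ω => by simpa using continuous_subtype_val)
  have h2 := ae_signature_letter (P := P) (X := ![fun u _ => (u : ℝ), M.price W θ]) M.start L2
    (by simpa using hP)
  filter_upwards [h1, h2] with ω h1 h2 t
  rw [delta, bracket_of_truncated_one (htrunc t), priceSig, signature_nil,
    h1 t (M.start_le t), h2 t (M.start_le t)]
  simp only [Matrix.cons_val_zero, Matrix.cons_val_one, xiDelta, projWord, List.nil_append,
    List.singleton_append, price_sub_start, affineHedge, baseHedge]
  simp only [start]
  ring

theorem gam_eq (htrunc : ∀ t : M.Time, IsTruncatedAt 1 (M.xiDelta t)) (t s : M.Time) (ω : Ω) :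
    M.gam P W θ t s ω = M.xi s [L2, L2] := by
  obtain ⟨h0, h1, h2, -⟩ := tensorMul_letter_two
    (p := M.priceSig P W θ M.start t ω) (q := M.priceSig P W θ t s ω)
    (signature_nil _ _ _ _) (signature_nil _ _ _ _)
  rw [gam, bracket_of_truncated_one (htrunc s), h0, h1, h2]
  simp [xiDelta, projWord]

theorem ae_gamTilde_eq (htrunc : ∀ t : M.Time, IsTruncatedAt 1 (M.xiDelta t))
    (hP : ∀ᵐ ω ∂P, Continuous fun t => M.price W θ t ω) (t : M.Time) :
    ∀ᵐ ω ∂P, ∀ s, t ≤ s →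
      M.gamTilde P W θ t s ω = 2 * M.xi s [L2, L2] * M.affineHedge W θ (s, ω) := by
  have h1 := fun r => ae_signature_letter (P := P) (X := ![fun u _ => (u : ℝ), M.price W θ]) r L1
    (Eventually.of_forall fun ω => by simpa using continuous_subtype_val)
  have h2 := fun r => ae_signature_letter (P := P) (X := ![fun u _ => (u : ℝ), M.price W θ]) r L2
    (by simpa using hP)
  filter_upwards [h1 M.start, h2 M.start, h1 t, h2 t] with ω a1 a2 b1 b2 s hs
  obtain ⟨e0, e1, e2, e11, e12, e21, e22⟩ := tensorMul_letter_two
    (p := M.priceSig P W θ M.start t ω) (q := M.priceSig P W θ t s ω)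
    (signature_nil _ _ _ _) (signature_nil _ _ _ _)
  rw [gamTilde, bracket_shuffle_self (htrunc s), e0, e1, e2, e11, e12, e21, e22, priceSig, priceSig,
    a1 t (M.start_le t), a2 t (M.start_le t), b1 s hs, b2 s hs]
  have h3 := M.price_sub_start (W := W) (θ := θ) s ω
  have h4 : M.price W θ t ω - M.price W θ M.start ω + (M.price W θ s ω - M.price W θ t ω) =
    M.μ * s + M.σ * (W s ω - W M.start ω) + M.ν * M.trades θ (s, ω) := by rw [← h3]; ring
  simp only [Matrix.cons_val_zero, Matrix.cons_val_one, xiDelta, projWord, List.nil_append,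
    List.singleton_append, h4, affineHedge, baseHedge]
  simp only [start]
  ring

/-! ### Square integrability -/

theorem mem_admissible_iff {ℱ : Filtration M.Time mΩ} [SFinite P] (hexp : M.exponent = 2) :
    θ ∈ M.admissible P ℱ ↔
      IsStronglyProgressive ℱ θ ∧ MemLp (Function.uncurry θ) 2 (M.leb.prod P) := by
  refine and_congr_right fun hθ => ?_
  have hm : StronglyMeasurable (Function.uncurry θ) := by
    have hT : M.T ∈ Set.Icc 0 M.T := ⟨M.T_pos.le, le_rfl⟩
    have h1 := (hθ ⟨M.T, hT⟩).mono (sup_le_sup le_rfl (MeasurableSpace.comap_mono (ℱ.le _)))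
    exact h1.comp_measurable (g := fun z : M.Time × Ω => (⟨z.1, z.1.2.2⟩, z.2))
      (by fun_prop)
  rw [memLp_two_iff_integrable_sq hm.aestronglyMeasurable, Integrable,
    and_iff_right (show AEStronglyMeasurable (fun z => Function.uncurry θ z ^ 2) (M.leb.prod P) from
      (hm.pow 2).aestronglyMeasurable), hasFiniteIntegral_iff_ofReal
      (Eventually.of_forall fun z => sq_nonneg _), lintegral_prod_symm _ (by fun_prop), hexp]
  rfl

theorem memLp_continuous_mul [SFinite P] {g : M.Time → ℝ} (hg : Continuous g)
    {f : M.Time × Ω → ℝ} (hf : MemLp f 2 (M.leb.prod P)) :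
    MemLp (fun z => g z.1 * f z) 2 (M.leb.prod P) := by
  obtain ⟨C, hC⟩ := isCompact_univ.exists_bound_of_continuousOn hg.continuousOn
  refine hf.of_le_mul (c := C) ?_ (Eventually.of_forall fun z => ?_)
  · exact (hg.measurable.comp measurable_fst).aestronglyMeasurable.mul hf.1
  · rw [norm_mul]
    gcongr
    exact hC _ trivial

theorem memLp_continuous [IsFiniteMeasure P] {g : M.Time → ℝ} (hg : Continuous g) :
    MemLp (fun z : M.Time × Ω => g z.1) 2 (M.leb.prod P) := by
  simpa using memLp_continuous_mul (P := P) hg (memLp_const (1 : ℝ))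

theorem memLp_increment [IsProbabilityMeasure P] {ℱ : Filtration M.Time mΩ}
    (hW : IsBrownianMotion P ℱ W) :
    MemLp (fun z : M.Time × Ω => W z.1 z.2 - W M.start z.2) 2 (M.leb.prod P) := by
  have hWm : ∀ t, StronglyMeasurable (W t) := fun t => (hW.adapted t).mono (ℱ.le t)
  have hmeas : AEStronglyMeasurable (fun z : M.Time × Ω => W z.1 z.2 - W M.start z.2)
      (M.leb.prod P) := by
    obtain ⟨N, hN, hNm, hN0⟩ := exists_measurable_superset_of_null hW.continuous
    let W' : M.Time → Ω → ℝ := fun t => Nᶜ.indicator (W t)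
    have h1 : StronglyMeasurable (Function.uncurry W') := by
      refine stronglyMeasurable_uncurry_of_continuous_of_stronglyMeasurable (fun ω => ?_)
        fun t => (hWm t).indicator hNm.compl
      by_cases hω : ω ∈ N
      · simpa [W', hω] using continuous_const
      · simp only [W', Set.indicator_of_mem (show ω ∈ Nᶜ from hω)]
        by_contra h
        exact hω (hN h)
    have h2 : ∀ᵐ z : M.Time × Ω ∂(M.leb.prod P), z.2 ∉ N :=
      Measure.quasiMeasurePreserving_snd.ae (measure_eq_zero_iff_ae_notMem.1 hN0)
    refine ⟨fun z => W' z.1 z.2 - W M.start z.2,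
      h1.sub ((hWm _).comp_measurable measurable_snd), ?_⟩
    filter_upwards [h2] with z hz
    simp [W', hz]
  have hlaw : ∀ t : M.Time, P.map (W t - W M.start) = gaussianReal 0 (Real.toNNReal t) := by
    intro t
    have := hW.increment_law M.start t (M.start_le t)
    simpa [start] using this
  have hsm : ∀ t : M.Time, AEMeasurable (W t - W M.start) P := fun t =>
    ((hWm t).sub (hWm _)).measurable.aemeasurable
  have hsq : ∀ t : M.Time, MemLp (W t - W M.start) 2 P := by
    intro t
    have h := memLp_id_gaussianReal' (μ := 0) (v := Real.toNNReal t) 2 (by simp)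
    rw [← hlaw t, memLp_map_measure_iff aestronglyMeasurable_id (hsm t)] at h
    exact h
  have hint : ∀ t : M.Time, ∫ ω, (W t ω - W M.start ω) ^ 2 ∂P = t := by
    intro t
    have h1 : ∫ x, x ^ 2 ∂(gaussianReal 0 (Real.toNNReal t)) = t := by
      have h2 := variance_of_integral_eq_zero (X := id) (μ := gaussianReal 0 (Real.toNNReal t))
        aemeasurable_id integral_id_gaussianReal
      rw [variance_id_gaussianReal] at h2
      simpa [t.2.1] using h2.symm
    rw [← hlaw t, integral_map (hsm t) (by fun_prop)] at h1
    exact h1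
  rw [memLp_two_iff_integrable_sq hmeas, integrable_prod_iff (show AEStronglyMeasurable
    (fun z : M.Time × Ω => (W z.1 z.2 - W M.start z.2) ^ 2) (M.leb.prod P) from hmeas.pow 2)]
  refine ⟨Eventually.of_forall fun t => (hsq t).integrable_sq, ?_⟩
  simp only [norm_pow, Real.norm_eq_abs, sq_abs, hint]
  refine (integrable_const M.T).mono' (by fun_prop) (Eventually.of_forall fun t => ?_)
  rw [Real.norm_of_nonneg t.2.1]
  exact t.2.2

theorem memLp_baseHedge [IsProbabilityMeasure P] {ℱ : Filtration M.Time mΩ}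
    (hW : IsBrownianMotion P ℱ W) : MemLp (M.baseHedge W) 2 (M.leb.prod P) := by
  have h1 : MemLp (fun z : M.Time × Ω => M.xi z.1 [L2] + M.xi z.1 [L1, L2] * z.1
      + M.xi z.1 [L2, L2] * (M.μ * z.1)) 2 (M.leb.prod P) := by
    refine memLp_continuous (g := fun t => M.xi t [L2] + M.xi t [L1, L2] * t
      + M.xi t [L2, L2] * (M.μ * t)) ?_
    have := M.continuous_xi
    fun_prop
  have h2 := memLp_continuous_mul (P := P) (g := fun t => M.xi t [L2, L2] * M.σ)
    ((M.continuous_xi _).mul continuous_const) (memLp_increment hW)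
  convert! h1.add h2 using 1
  funext z
  simp only [baseHedge, Pi.add_apply]
  ring

theorem memLp_affineHedge [IsProbabilityMeasure P] {ℱ : Filtration M.Time mΩ}
    (hW : IsBrownianMotion P ℱ W) (hθ : MemLp (Function.uncurry θ) 2 (M.leb.prod P)) :
    MemLp (M.affineHedge W θ) 2 (M.leb.prod P) :=
  (memLp_baseHedge hW).add (memLp_continuous_mul (g := fun t => M.ν * M.xi t [L2, L2])
    (continuous_const.mul (M.continuous_xi _)) (MemLp.timeInt measurableSet_past hθ))

theorem ae_continuous_price_of_memLp [SFinite P] {ℱ : Filtration M.Time mΩ}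
    (hW : IsBrownianMotion P ℱ W) (hθ : MemLp (Function.uncurry θ) 2 (M.leb.prod P)) :
    ∀ᵐ ω ∂P, Continuous fun t => M.price W θ t ω := by
  refine ae_continuous_price hW.continuous ?_
  filter_upwards [ae_memLp_slice hθ] with ω hω
  exact hω.integrable (by norm_num)

end Market

end SigHedging

namespace SigHedging

section

variable {τ Ω : Type*} [MeasurableSpace τ] [MeasurableSpace Ω] {m : Measure τ} {P : Measure Ω}
  {A : τ → Set τ}

theorem integrable_timeInt_slice [SFinite m] [SFinite P] {f : τ × Ω → ℝ}
    (hf : Integrable f (m.prod P)) (t : τ) : Integrable (fun ω => timeInt m A f (t, ω)) P := by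
  have h : Integrable f ((m.restrict (A t)).prod P) := by
    have := hf.restrict (s := A t ×ˢ Set.univ)
    rwa [← Measure.prod_restrict, Measure.restrict_univ] at this
  exact h.integral_prod_right

theorem ae_timeInt_linearCombination [IsFiniteMeasure m] [SFinite P] {f₁ f₂ f₃ f₄ : τ × Ω → ℝ}
    (h₁ : MemLp f₁ 2 (m.prod P)) (h₂ : MemLp f₂ 2 (m.prod P)) (h₃ : MemLp f₃ 2 (m.prod P))
    (h₄ : MemLp f₄ 2 (m.prod P)) (a b : ℝ) :
    ∀ᵐ ω ∂P, ∀ t, timeInt m A (fun z => a * (f₁ z - f₂ z) - b * (f₃ z - f₄ z)) (t, ω) =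
      a * (timeInt m A f₁ (t, ω) - timeInt m A f₂ (t, ω))
        - b * (timeInt m A f₃ (t, ω) - timeInt m A f₄ (t, ω)) := by
  have hi : ∀ {f : τ × Ω → ℝ}, MemLp f 2 (m.prod P) →
      ∀ᵐ ω ∂P, ∀ t, Integrable (fun s => f (s, ω)) (m.restrict (A t)) := by
    intro f hf
    filter_upwards [ae_memLp_slice hf] with ω hω t
    exact (hω.integrable (by norm_num)).restrict
  filter_upwards [hi h₁, hi h₂, hi h₃, hi h₄] with ω i₁ i₂ i₃ i₄ t
  simp only [timeInt]
  have j₁ : Integrable (fun s => a * (f₁ (s, ω) - f₂ (s, ω))) (m.restrict (A t)) :=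
    ((i₁ t).sub (i₂ t)).const_mul a
  have j₂ : Integrable (fun s => b * (f₃ (s, ω) - f₄ (s, ω))) (m.restrict (A t)) :=
    ((i₃ t).sub (i₄ t)).const_mul b
  rw [integral_sub j₁ j₂, integral_const_mul, integral_const_mul,
    integral_sub (i₁ t) (i₂ t), integral_sub (i₃ t) (i₄ t)]

theorem ae_timeInt_sub [IsFiniteMeasure m] [SFinite P] {f g : τ × Ω → ℝ}
    (hf : MemLp f 2 (m.prod P)) (hg : MemLp g 2 (m.prod P)) :
    ∀ᵐ ω ∂P, ∀ t, timeInt m A (fun z => f z - g z) (t, ω) =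
      timeInt m A f (t, ω) - timeInt m A g (t, ω) := by
  filter_upwards [ae_timeInt_linearCombination (A := A) hf hg hf hg 1 0] with ω h t
  simpa using h t

end

namespace Market

variable {M : Market} {Ω : Type*} {mΩ : MeasurableSpace Ω} {P : Measure Ω}
  {W θ φ : M.Time → Ω → ℝ} {ℱ : Filtration M.Time mΩ}

/-! ### Monotonicity -/

/-- The inventory in excess of the frictionless hedge. -/
noncomputable def excess (M : Market) (W θ : M.Time → Ω → ℝ) (z : M.Time × Ω) : ℝ :=
  M.X₀ + M.trades θ z - M.affineHedge W θ z

theorem excess_eq (z : M.Time × Ω) :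
    M.excess W θ z = M.slack z.1 * M.trades θ z + (M.X₀ - M.baseHedge W z) := by
  simp only [excess, affineHedge, slack]
  ring

theorem memLp_inventory [IsFiniteMeasure P]
    (hθ : MemLp (Function.uncurry θ) 2 (M.leb.prod P)) :
    MemLp (fun z => M.X₀ + M.trades θ z) 2 (M.leb.prod P) := by
  have h1 : MemLp (fun _ : M.Time × Ω => M.X₀) 2 (M.leb.prod P) := memLp_const M.X₀
  have h2 : MemLp (M.trades θ) 2 (M.leb.prod P) := MemLp.timeInt measurableSet_past hθ
  exact h1.add h2

theorem memLp_excess [IsProbabilityMeasure P] (hW : IsBrownianMotion P ℱ W)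
    (hθ : MemLp (Function.uncurry θ) 2 (M.leb.prod P)) :
    MemLp (M.excess W θ) 2 (M.leb.prod P) :=
  (memLp_inventory hθ).sub (memLp_affineHedge hW hθ)

theorem memLp_slack_mul [SFinite P] {f : M.Time × Ω → ℝ} (hf : MemLp f 2 (M.leb.prod P)) :
    MemLp (fun z => M.slack z.1 * f z) 2 (M.leb.prod P) :=
  memLp_continuous_mul M.continuous_slack hf

theorem integrable_of_memLp_two [IsFiniteMeasure P] {f : M.Time × Ω → ℝ}
    (hf : MemLp f 2 (M.leb.prod P)) : Integrable f (M.leb.prod P) :=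
  hf.integrable (by norm_num)

theorem opA_ae_eq [IsProbabilityMeasure P] (htrunc : ∀ t : M.Time, IsTruncatedAt 1 (M.xiDelta t))
    (hW : IsBrownianMotion P ℱ W) (hθ : MemLp (Function.uncurry θ) 2 (M.leb.prod P))
    (t : M.Time) :
    M.opA P ℱ W θ t =ᵐ[P] fun ω => M.excess W θ (t, ω) +
      (P[fun ω => timeInt M.leb Set.Ioi (fun z => M.slack z.1 * θ z.1 z.2) (t, ω) | ℱ t]) ω := by
  filter_upwards [ae_delta_eq htrunc (ae_continuous_price_of_memLp hW hθ)] with ω h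
  have hY : (fun (s : M.Time) ω => θ s ω * (1 - M.ν * M.gam P W θ t s ω)) =
      fun s ω => M.slack s * θ s ω := by
    funext s ω
    rw [gam_eq htrunc, slack, mul_comm]
  rw [opA, h t, hY]
  rfl

theorem opB_ae_eq [IsProbabilityMeasure P] (htrunc : ∀ t : M.Time, IsTruncatedAt 1 (M.xiDelta t))
    (hW : IsBrownianMotion P ℱ W) (hθ : MemLp (Function.uncurry θ) 2 (M.leb.prod P))
    (t : M.Time) :
    M.opB P ℱ W θ t =ᵐ[P]
      P[fun ω => timeInt M.leb Set.Ioi (fun z => M.slack z.1 * M.excess W θ z) (t, ω) | ℱ t] := by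
  have hP := ae_continuous_price_of_memLp hW hθ
  have hX := memLp_inventory (M := M) hθ
  have hH := memLp_affineHedge hW hθ
  set f : M.Time × Ω → ℝ := fun z => M.slack z.1 * (M.X₀ + M.trades θ z)
  set g : M.Time × Ω → ℝ := fun z => M.slack z.1 * M.affineHedge W θ z
  have h1 : M.condFuture P ℱ t (fun s ω => M.inventory θ s ω * (1 - M.ν * M.gam P W θ t s ω)) =
      P[fun ω => timeInt M.leb Set.Ioi f (t, ω) | ℱ t] := by
    have hY : (fun (s : M.Time) ω => M.inventory θ s ω * (1 - M.ν * M.gam P W θ t s ω)) =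
        fun s ω => f (s, ω) := by
      funext s ω
      rw [gam_eq htrunc, mul_comm]
      rfl
    rw [hY]
    rfl
  have h2 : M.condFuture P ℱ t
      (fun s ω => 1 / 2 * M.ν * M.gamTilde P W θ t s ω - M.delta P W θ s ω) =ᵐ[P]
      P[fun ω => - timeInt M.leb Set.Ioi g (t, ω) | ℱ t] := by
    refine condExp_congr_ae ?_
    filter_upwards [ae_delta_eq htrunc hP, ae_gamTilde_eq htrunc hP t] with ω a b
    rw [timeInt, ← integral_neg]
    refine setIntegral_congr_fun measurableSet_Ioi fun s hs => ?_
    simp only [a s, b s (le_of_lt hs), g, slack]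
    ring
  have h3 := condExp_add (m := ℱ t)
    (integrable_timeInt_slice (A := Set.Ioi)
      (integrable_of_memLp_two (memLp_slack_mul hX)) t)
    (integrable_timeInt_slice (A := Set.Ioi)
      (integrable_of_memLp_two (memLp_slack_mul hH)) t).neg
  have h4 : (fun ω => timeInt M.leb Set.Ioi (fun z => M.slack z.1 * M.excess W θ z) (t, ω)) =ᵐ[P]
      (fun ω => timeInt M.leb Set.Ioi f (t, ω)) + -(fun ω => timeInt M.leb Set.Ioi g (t, ω)) := by
    filter_upwards [ae_timeInt_sub (A := Set.Ioi) (memLp_slack_mul hX) (memLp_slack_mul hH)]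
      with ω h
    simp only [Pi.add_apply, Pi.neg_apply, ← sub_eq_add_neg]
    rw [← h t]
    simp only [excess, mul_sub]
  filter_upwards [h2, h3, condExp_congr_ae (m := ℱ t) h4] with ω h2 h3 h4
  rw [h4, h3, opB, h1, h2]
  rfl

theorem opC_eq (htrunc : ∀ t : M.Time, IsTruncatedAt 1 (M.xiDelta t)) (t : M.Time) :
    M.opC P ℱ W θ t = M.opC P ℱ W φ t := by
  funext ω
  simp only [opC, gam_eq htrunc]

theorem monotoneField_sub_ae_eq [IsProbabilityMeasure P]
    (htrunc : ∀ t : M.Time, IsTruncatedAt 1 (M.xiDelta t)) (hW : IsBrownianMotion P ℱ W) (ε : ℝ)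
    (hθ : MemLp (Function.uncurry θ) 2 (M.leb.prod P))
    (hφ : MemLp (Function.uncurry φ) 2 (M.leb.prod P)) (t : M.Time) :
    ∀ᵐ ω ∂P, M.monotoneField P ℱ W ε θ t ω - M.monotoneField P ℱ W ε φ t ω =
      (ε - 2 * M.η) * (θ t ω - φ t ω) + M.ν * (M.slack t * M.trades (θ - φ) (t, ω)) +
      (P[fun ω => timeInt M.leb Set.Ioi (fun z => M.ν * (M.slack z.1 * (θ - φ) z.1 z.2)
        - M.lam * M.σ ^ 2 * (M.slack z.1 * (M.slack z.1 * M.trades (θ - φ) z))) (t, ω) | ℱ t]) ω := by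
  have htr := ae_timeInt_sub (A := Set.Iic) hθ hφ
  have sθ := memLp_slack_mul hθ
  have sφ := memLp_slack_mul hφ
  have eθ := memLp_slack_mul (memLp_excess hW hθ)
  have eφ := memLp_slack_mul (memLp_excess hW hφ)
  have hint := fun {f : M.Time × Ω → ℝ} (hf : MemLp f 2 (M.leb.prod P)) =>
    integrable_timeInt_slice (A := Set.Ioi) (integrable_of_memLp_two hf) t
  have hq : (fun z : M.Time × Ω => M.ν * (M.slack z.1 * (θ - φ) z.1 z.2)
        - M.lam * M.σ ^ 2 * (M.slack z.1 * (M.slack z.1 * M.trades (θ - φ) z))) =ᵐ[M.leb.prod P]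
      fun z => M.ν * (M.slack z.1 * Function.uncurry θ z - M.slack z.1 * Function.uncurry φ z)
        - M.lam * M.σ ^ 2 * (M.slack z.1 * M.excess W θ z - M.slack z.1 * M.excess W φ z) := by
    have := (Measure.quasiMeasurePreserving_snd (μ := M.leb)).ae htr
    filter_upwards [this] with z hz
    have hz' : M.trades (θ - φ) z = M.trades θ z - M.trades φ z := hz z.1
    rw [hz', excess_eq, excess_eq]
    simp only [Pi.sub_apply, Function.uncurry]
    ring
  have hfut : (fun ω => timeInt M.leb Set.Ioi (fun z => M.ν * (M.slack z.1 * (θ - φ) z.1 z.2)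
        - M.lam * M.σ ^ 2 * (M.slack z.1 * (M.slack z.1 * M.trades (θ - φ) z))) (t, ω)) =ᵐ[P]
      M.ν • ((fun ω => timeInt M.leb Set.Ioi (fun z => M.slack z.1 * Function.uncurry θ z) (t, ω))
        - fun ω => timeInt M.leb Set.Ioi (fun z => M.slack z.1 * Function.uncurry φ z) (t, ω))
      - (M.lam * M.σ ^ 2) •
        ((fun ω => timeInt M.leb Set.Ioi (fun z => M.slack z.1 * M.excess W θ z) (t, ω))
        - fun ω => timeInt M.leb Set.Ioi (fun z => M.slack z.1 * M.excess W φ z) (t, ω)) := by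
    filter_upwards [timeInt_congr_ae (A := Set.Ioi) hq,
      ae_timeInt_linearCombination (A := Set.Ioi) sθ sφ eθ eφ M.ν (M.lam * M.σ ^ 2)] with ω h1 h2
    rw [h1 t, h2 t]
    rfl
  have c1 := condExp_congr_ae (m := ℱ t) hfut
  have c2 := condExp_sub (μ := P) (((hint sθ).sub (hint sφ)).smul M.ν)
    (((hint eθ).sub (hint eφ)).smul (M.lam * M.σ ^ 2)) (ℱ t)
  have c3 := condExp_smul (μ := P) M.ν ((fun ω => timeInt M.leb Set.Ioi
    (fun z => M.slack z.1 * Function.uncurry θ z) (t, ω))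
        - fun ω => timeInt M.leb Set.Ioi (fun z => M.slack z.1 * Function.uncurry φ z) (t, ω)) (ℱ t)
  have c4 := condExp_smul (μ := P) (M.lam * M.σ ^ 2) ((fun ω => timeInt M.leb Set.Ioi
    (fun z => M.slack z.1 * M.excess W θ z) (t, ω))
        - fun ω => timeInt M.leb Set.Ioi (fun z => M.slack z.1 * M.excess W φ z) (t, ω)) (ℱ t)
  have c5 := condExp_sub (μ := P) (hint sθ) (hint sφ) (ℱ t)
  have c6 := condExp_sub (μ := P) (hint eθ) (hint eφ) (ℱ t)
  filter_upwards [c1, c2, c3, c4, c5, c6, opA_ae_eq htrunc hW hθ t, opA_ae_eq htrunc hW hφ t,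
    opB_ae_eq htrunc hW hθ t, opB_ae_eq htrunc hW hφ t, htr]
    with ω c1 c2 c3 c4 c5 c6 a1 a2 b1 b2 htr
  have htr' : M.trades (θ - φ) (t, ω) = M.trades θ (t, ω) - M.trades φ (t, ω) := htr t
  rw [c1, c2, Pi.sub_apply, c3, c4, Pi.smul_apply, Pi.smul_apply, c5, c6, htr']
  simp only [monotoneField, a1, a2, b1, b2, opC_eq (θ := θ) (φ := φ) htrunc,
    M.exponent_eq_two htrunc, excess_eq, Pi.sub_apply, smul_eq_mul, Function.uncurry]
  norm_num
  ring

theorem mul_integral_slack_le [SFinite P] (hν : 0 < M.ν) {ε : ℝ}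
    (hbound : ∀ t : M.Time, 1 / M.ν * (1 - (2 * M.η - ε) / (M.T * M.ν)) ≤ M.xi t [L2, L2] ∧
      M.xi t [L2, L2] ≤ 1 / M.ν) {f : M.Time × Ω → ℝ} (hf : MemLp f 2 (M.leb.prod P)) :
    M.ν * ∫ z, f z * (M.slack z.1 * timeInt M.leb Set.Iic f z) ∂(M.leb.prod P)
      ≤ (2 * M.η - ε) / 2 * ∫ z, f z ^ 2 ∂(M.leb.prod P) := by
  have hT := M.T_pos
  have h := integral_mul_timeInt_past_le (P := P) (κ := (2 * M.η - ε) / (M.T * M.ν))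
    M.continuous_slack.measurable (fun t => ?_) (fun t => ?_) hf
  · rw [leb_real_univ] at h
    refine (mul_le_mul_of_nonneg_left h hν.le).trans (le_of_eq ?_)
    field_simp
  · have := mul_le_mul_of_nonneg_left (hbound t).2 hν.le
    rw [mul_one_div_cancel hν.ne'] at this
    unfold slack
    linarith
  · have := mul_le_mul_of_nonneg_left (hbound t).1 hν.le
    rw [← mul_assoc, mul_one_div_cancel hν.ne'] at this
    unfold slack
    linarith

theorem monotonicityCondition [IsProbabilityMeasure P] (hW : IsBrownianMotion P ℱ W)
    (hν : 0 < M.ν) (htrunc : ∀ t : M.Time, IsTruncatedAt 1 (M.xiDelta t)) {ε : ℝ}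
    (hbound : ∀ t : M.Time, 1 / M.ν * (1 - (2 * M.η - ε) / (M.T * M.ν)) ≤ M.xi t [L2, L2] ∧
      M.xi t [L2, L2] ≤ 1 / M.ν) : M.MonotonicityCondition P ℱ W ε := by
  intro θ hθ φ hφ
  obtain ⟨pθ, hθ⟩ := (mem_admissible_iff (M.exponent_eq_two htrunc)).1 hθ
  obtain ⟨pφ, hφ⟩ := (mem_admissible_iff (M.exponent_eq_two htrunc)).1 hφ
  set d : M.Time × Ω → ℝ := fun z => (θ - φ) z.1 z.2
  have hd : MemLp d 2 (M.leb.prod P) := hθ.sub hφ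
  have hsV := memLp_slack_mul (MemLp.timeInt measurableSet_past hd)
  have hssV := memLp_slack_mul hsV
  set q : M.Time × Ω → ℝ := fun z => M.ν * (M.slack z.1 * d z)
        - M.lam * M.σ ^ 2 * (M.slack z.1 * (M.slack z.1 * timeInt M.leb Set.Iic d z))
  have hq : MemLp q 2 (M.leb.prod P) :=
    ((memLp_slack_mul hd).const_mul M.ν).sub (hssV.const_mul (M.lam * M.σ ^ 2))
  have hfq := MemLp.timeInt measurableSet_future hq
  set G : M.Time × Ω → ℝ := fun z => (ε - 2 * M.η) * d z ^ 2
    + M.ν * (d z * (M.slack z.1 * timeInt M.leb Set.Iic d z)) + d z * timeInt M.leb Set.Ioi q z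
  have i1 := hd.integrable_sq.const_mul (ε - 2 * M.η)
  have i2 := (integrable_mul_of_memLp_two hd hsV).const_mul M.ν
  have i3 := integrable_mul_of_memLp_two hd hfq
  have i12 : Integrable (fun z => (ε - 2 * M.η) * d z ^ 2
    + M.ν * (d z * (M.slack z.1 * timeInt M.leb Set.Iic d z))) (M.leb.prod P) := i1.add i2
  have hG : Integrable G (M.leb.prod P) := i12.add i3
  have key : ∀ᵐ t ∂M.leb, Integrable (fun ω =>
      (M.monotoneField P ℱ W ε θ - M.monotoneField P ℱ W ε φ) t ω * (θ - φ) t ω) P ∧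
      ∫ ω, (M.monotoneField P ℱ W ε θ - M.monotoneField P ℱ W ε φ) t ω * (θ - φ) t ω ∂P
        = ∫ ω, G (t, ω) ∂P := by
    filter_upwards [i12.prod_right_ae, i3.prod_right_ae] with t j12 j3
    have hdm : StronglyMeasurable[ℱ t] fun ω => d (t, ω) :=
      (pθ.stronglyAdapted t).sub (pφ.stronglyAdapted t)
    have hZ := integrable_timeInt_slice (P := P) (A := Set.Ioi)
      (integrable_of_memLp_two hq) t
    have hpull := condExp_mul_of_stronglyMeasurable_left hdm j3 hZ
    set C := P[fun ω => timeInt M.leb Set.Ioi q (t, ω) | ℱ t] with hC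
    have hdC : Integrable (fun ω => d (t, ω) * C ω) P := integrable_condExp.congr hpull
    have hE : ∫ ω, d (t, ω) * C ω ∂P = ∫ ω, d (t, ω) * timeInt M.leb Set.Ioi q (t, ω) ∂P := by
      exact (integral_congr_ae hpull).symm.trans (integral_condExp (ℱ.le t))
    have hae : (fun ω => (M.monotoneField P ℱ W ε θ - M.monotoneField P ℱ W ε φ) t ω
        * (θ - φ) t ω) =ᵐ[P] fun ω => ((ε - 2 * M.η) * d (t, ω) ^ 2
          + M.ν * (d (t, ω) * (M.slack t * timeInt M.leb Set.Iic d (t, ω)))) + d (t, ω) * C ω := by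
      filter_upwards [monotoneField_sub_ae_eq htrunc hW ε hθ hφ t] with ω h
      have h' : (M.monotoneField P ℱ W ε θ - M.monotoneField P ℱ W ε φ) t ω =
        (ε - 2 * M.η) * d (t, ω) + M.ν * (M.slack t * timeInt M.leb Set.Iic d (t, ω)) + C ω := h
      rw [h']
      simp only [d]
      ring
    refine ⟨(j12.add hdC).congr hae.symm, ?_⟩
    rw [integral_congr_ae hae, integral_add j12 hdC, hE, ← integral_add j12 j3]
  have key2 := key.mono fun t h => h.2
  refine ⟨⟨key.mono fun t h => h.1, hG.integral_prod_left.congr (key2.mono fun t h => h.symm)⟩, ?_⟩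
  rw [pairing, integral_congr_ae key2, ← integral_prod _ hG]
  have hdual := integral_timeInt_past_mul hd hq
  have hVq : ∫ z, timeInt M.leb Set.Iic d z * q z ∂(M.leb.prod P) =
      M.ν * (∫ z, d z * (M.slack z.1 * timeInt M.leb Set.Iic d z) ∂(M.leb.prod P))
        - M.lam * M.σ ^ 2 *
          ∫ z, (M.slack z.1 * timeInt M.leb Set.Iic d z) ^ 2 ∂(M.leb.prod P) := by
    rw [← integral_const_mul, ← integral_const_mul,
      ← integral_sub i2 (hsV.integrable_sq.const_mul _)]
    refine integral_congr_ae (Eventually.of_forall fun z => ?_)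
    simp only [q]
    ring
  have hGint : ∫ z, G z ∂(M.leb.prod P) = (ε - 2 * M.η) * (∫ z, d z ^ 2 ∂(M.leb.prod P))
      + M.ν * (∫ z, d z * (M.slack z.1 * timeInt M.leb Set.Iic d z) ∂(M.leb.prod P))
      + ∫ z, d z * timeInt M.leb Set.Ioi q z ∂(M.leb.prod P) := by
    rw [integral_add i12 i3, integral_add i1 i2, integral_const_mul, integral_const_mul]
  rw [hGint, ← hdual, hVq]
  have h1 := mul_integral_slack_le hν hbound hd
  have h2 : 0 ≤ M.lam * M.σ ^ 2 *
      ∫ z, (M.slack z.1 * timeInt M.leb Set.Iic d z) ^ 2 ∂(M.leb.prod P) :=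
    mul_nonneg (mul_nonneg M.lam_pos.le (sq_nonneg _)) (integral_nonneg fun z => sq_nonneg _)
  linarith

end Market

end SigHedging

namespace SigHedging

/-! ### Maximization of strongly concave quadratic functionals -/

section Concave

variable {E : Type*} [NormedAddCommGroup E]

theorem exists_isMaxOn_of_strongly_midpoint_concave [NormedSpace ℝ E] [CompleteSpace E]
    {F : E → ℝ} (hF : Continuous F) {k : ℝ} (hk : 0 < k) {K : Set E} (hKc : IsClosed K)
    (hKne : K.Nonempty) (hKm : ∀ x ∈ K, ∀ y ∈ K, (1 / 2 : ℝ) • (x + y) ∈ K)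
    (hmid : ∀ x y, (F x + F y) / 2 + k * ‖x - y‖ ^ 2 ≤ F ((1 / 2 : ℝ) • (x + y)))
    (hbdd : BddAbove (F '' K)) : ∃ x ∈ K, ∀ y ∈ K, F y ≤ F x := by
  set S := sSup (F '' K)
  have hS : ∀ y ∈ K, F y ≤ S := fun y hy => le_csSup hbdd ⟨y, hy, rfl⟩
  have hex : ∀ n : ℕ, ∃ x ∈ K, S - 1 / ((n : ℝ) + 1) < F x := by
    intro n
    obtain ⟨_, ⟨x, hx, rfl⟩, h⟩ := exists_lt_of_lt_csSup (hKne.image F)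
      (show S - 1 / ((n : ℝ) + 1) < S by
        have : (0 : ℝ) < 1 / ((n : ℝ) + 1) := by positivity
        linarith)
    exact ⟨x, hx, h⟩
  choose u huK hu using hex
  have hdist : ∀ a b N : ℕ, N ≤ a → N ≤ b → k * ‖u a - u b‖ ^ 2 ≤ 1 / ((N : ℝ) + 1) := by
    intro a b N ha hb
    have h1 := hmid (u a) (u b)
    have h2 := hS _ (hKm _ (huK a) _ (huK b))
    have h3 : 1 / ((a : ℝ) + 1) ≤ 1 / ((N : ℝ) + 1) := by gcongr
    have h4 : 1 / ((b : ℝ) + 1) ≤ 1 / ((N : ℝ) + 1) := by gcongr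
    linarith [hu a, hu b]
  have hcau : CauchySeq u := by
    refine Metric.cauchySeq_iff.2 fun e he => ?_
    obtain ⟨N, hN⟩ := exists_nat_one_div_lt (show 0 < k * e ^ 2 by positivity)
    refine ⟨N, fun a ha b hb => ?_⟩
    rw [dist_eq_norm]
    have h := (hdist a b N ha hb).trans_lt hN
    exact lt_of_pow_lt_pow_left₀ 2 he.le (lt_of_mul_lt_mul_left h hk.le)
  obtain ⟨x, hx⟩ := cauchySeq_tendsto_of_complete hcau
  refine ⟨x, hKc.mem_of_tendsto hx (Eventually.of_forall huK), fun y hy => ?_⟩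
  have h1 : Tendsto (fun n => F (u n)) atTop (𝓝 (F x)) := (hF.tendsto x).comp hx
  have h2 : Tendsto (fun n : ℕ => S - 1 / ((n : ℝ) + 1)) atTop (𝓝 (S - 0)) :=
    tendsto_const_nhds.sub tendsto_one_div_add_atTop_nhds_zero_nat
  have h3 := le_of_tendsto_of_tendsto' h2 h1 fun n => (hu n).le
  linarith [hS y hy]

theorem eq_of_isMaxOn_of_strongly_midpoint_concave [NormedSpace ℝ E] {F : E → ℝ} {k : ℝ}
    (hk : 0 < k) {K : Set E} (hKm : ∀ x ∈ K, ∀ y ∈ K, (1 / 2 : ℝ) • (x + y) ∈ K)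
    (hmid : ∀ x y, (F x + F y) / 2 + k * ‖x - y‖ ^ 2 ≤ F ((1 / 2 : ℝ) • (x + y)))
    {x y : E} (hx : x ∈ K) (hy : y ∈ K) (hxm : ∀ z ∈ K, F z ≤ F x) (hym : ∀ z ∈ K, F z ≤ F y) :
    x = y := by
  have h1 := hmid x y
  have h2 := hxm _ (hKm x hx y hy)
  have h3 := hym _ hx
  have h4 : ‖x - y‖ ^ 2 ≤ 0 := by
    by_contra! h
    have := mul_pos hk h
    linarith
  have h5 : ‖x - y‖ = 0 := by
    have := sq_nonneg ‖x - y‖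
    exact pow_eq_zero_iff two_ne_zero |>.1 (le_antisymm h4 this)
  exact sub_eq_zero.1 (norm_eq_zero.1 h5)

variable [InnerProductSpace ℝ E]

/-- The functional `⟪b + ν f, K f + h⟫ - η ‖f‖² - c ‖K f + h‖²`. -/
noncomputable def quadraticGain (K : E →L[ℝ] E) (b h : E) (ν η c : ℝ) (f : E) : ℝ :=
  inner ℝ (b + ν • f) (K f + h) - η * ‖f‖ ^ 2 - c * ‖K f + h‖ ^ 2

theorem continuous_quadraticGain (K : E →L[ℝ] E) (b h : E) (ν η c : ℝ) :
    Continuous (quadraticGain K b h ν η c) := by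
  unfold quadraticGain
  fun_prop

variable {K : E →L[ℝ] E} {ν η c ε : ℝ}

theorem quadraticGain_midpoint (b h : E) (hc : 0 ≤ c)
    (hK : ∀ f, ν * inner ℝ f (K f) ≤ (η - ε / 2) * ‖f‖ ^ 2) (x y : E) :
    (quadraticGain K b h ν η c x + quadraticGain K b h ν η c y) / 2 + ε / 8 * ‖x - y‖ ^ 2
      ≤ quadraticGain K b h ν η c ((1 / 2 : ℝ) • (x + y)) := by
  have h1 := hK (x - y)
  have h2 : 0 ≤ c * ‖K x - K y‖ ^ 2 := by positivity
  have key : quadraticGain K b h ν η c ((1 / 2 : ℝ) • (x + y)) =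
      (quadraticGain K b h ν η c x + quadraticGain K b h ν η c y) / 2
      - 1 / 4 * (ν * inner ℝ (x - y) (K (x - y)) - η * ‖x - y‖ ^ 2 - c * ‖K x - K y‖ ^ 2) := by
    simp only [quadraticGain, ← real_inner_self_eq_norm_sq, map_smul, map_add, map_sub,
      inner_add_left, inner_add_right, inner_sub_left, inner_sub_right, inner_smul_left,
      inner_smul_right, RCLike.conj_to_real]
    rw [real_inner_comm x y, real_inner_comm (K x) (K y), real_inner_comm (K x) h,
      real_inner_comm (K y) h]
    ring
  rw [key]
  linarith

theorem bddAbove_quadraticGain (b h : E) (hc : 0 ≤ c) (hε : 0 < ε)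
    (hK : ∀ f, ν * inner ℝ f (K f) ≤ (η - ε / 2) * ‖f‖ ^ 2) (S : Set E) :
    BddAbove (quadraticGain K b h ν η c '' S) := by
  set B := ‖b‖ * ‖K‖ + |ν| * ‖h‖
  refine ⟨‖b‖ * ‖h‖ + B ^ 2 / (2 * ε), ?_⟩
  rintro _ ⟨f, -, rfl⟩
  have h1 : inner ℝ b (K f) ≤ ‖b‖ * (‖K‖ * ‖f‖) := (real_inner_le_norm _ _).trans (by
    gcongr
    exact K.le_opNorm f)
  have h2 : inner ℝ b h ≤ ‖b‖ * ‖h‖ := real_inner_le_norm _ _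
  have h3 : ν * inner ℝ f h ≤ |ν| * (‖f‖ * ‖h‖) := by
    refine (le_abs_self _).trans ?_
    rw [abs_mul]
    gcongr
    exact abs_real_inner_le_norm _ _
  have h4 := hK f
  have h5 : 0 ≤ c * ‖K f + h‖ ^ 2 := by positivity
  have h6 : B * ‖f‖ - ε / 2 * ‖f‖ ^ 2 ≤ B ^ 2 / (2 * ε) := by
    rw [le_div_iff₀ (by positivity)]
    nlinarith [sq_nonneg (B - ε * ‖f‖)]
  have h7 : B * ‖f‖ = ‖b‖ * (‖K‖ * ‖f‖) + |ν| * (‖f‖ * ‖h‖) := by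
    simp only [B]
    ring
  simp only [quadraticGain, inner_add_left, inner_add_right, inner_smul_left, RCLike.conj_to_real]
  linarith

end Concave

namespace Market

variable {M : Market} {Ω : Type*} {mΩ : MeasurableSpace Ω} {P : Measure Ω}
  {W θ φ : M.Time → Ω → ℝ} {ℱ : Filtration M.Time mΩ}

/-! ### The gain functional -/

theorem memLp_slack_mul_trades [SFinite P] {f : M.Time × Ω → ℝ}
    (hf : MemLp f 2 (M.leb.prod P)) :
    MemLp (fun z => M.slack z.1 * timeInt M.leb Set.Iic f z) 2 (M.leb.prod P) :=
  memLp_slack_mul (MemLp.timeInt measurableSet_past hf)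

theorem exists_slackTrades [SFinite P] :
    ∃ K : Lp ℝ 2 (M.leb.prod P) →L[ℝ] Lp ℝ 2 (M.leb.prod P), ∀ f : Lp ℝ 2 (M.leb.prod P),
      K f =ᵐ[M.leb.prod P] fun z => M.slack z.1 * timeInt M.leb Set.Iic f z := by
  have hm := fun f : Lp ℝ 2 (M.leb.prod P) => memLp_slack_mul_trades (M := M) (Lp.memLp f)
  have hcoe := fun f => (hm f).coeFn_toLp
  obtain ⟨C, hC⟩ := isCompact_univ.exists_bound_of_continuousOn M.continuous_slack.continuousOn
  have hlift : ∀ {p : Ω → Prop}, (∀ᵐ ω ∂P, p ω) → ∀ᵐ z : M.Time × Ω ∂(M.leb.prod P), p z.2 :=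
    fun h => Measure.quasiMeasurePreserving_snd.ae h
  have hslice : ∀ f : Lp ℝ 2 (M.leb.prod P), ∀ᵐ ω ∂P, Integrable (fun t => f (t, ω)) M.leb := by
    intro f
    filter_upwards [ae_memLp_slice (Lp.memLp f)] with ω hω
    exact hω.integrable (by norm_num)
  let L : Lp ℝ 2 (M.leb.prod P) →ₗ[ℝ] Lp ℝ 2 (M.leb.prod P) :=
    { toFun := fun f => (hm f).toLp _
      map_add' := fun f g => by
        refine Lp.ext ?_
        filter_upwards [hcoe (f + g), hcoe f, hcoe g, Lp.coeFn_add ((hm f).toLp _) ((hm g).toLp _),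
          hlift (timeInt_congr_ae (A := Set.Iic) (Lp.coeFn_add f g)), hlift (hslice f),
          hlift (hslice g)] with z h1 h2 h3 h4 h5 h6 h7
        rw [h4, Pi.add_apply, h1, h2, h3, h5 z.1]
        simp only [timeInt, Pi.add_apply]
        rw [integral_add h6.restrict h7.restrict, mul_add]
      map_smul' := fun a f => by
        refine Lp.ext ?_
        filter_upwards [hcoe (a • f), hcoe f, Lp.coeFn_smul a ((hm f).toLp _),
          hlift (timeInt_congr_ae (A := Set.Iic) (Lp.coeFn_smul a f))] with z h1 h2 h4 h5
        rw [RingHom.id_apply, h4, Pi.smul_apply, h1, h2, h5 z.1]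
        simp only [timeInt, Pi.smul_apply, smul_eq_mul]
        rw [integral_const_mul]
        ring }
  refine ⟨L.mkContinuous (C * M.leb.real Set.univ) fun f => ?_, hcoe⟩
  have h1 : ‖L f‖ ≤ C * ‖(MemLp.timeInt (A := Set.Iic) measurableSet_past (Lp.memLp f)).toLp _‖ := by
    refine Lp.norm_le_mul_norm_of_ae_le_mul ?_
    filter_upwards [hcoe f, (MemLp.timeInt (A := Set.Iic) measurableSet_past
      (Lp.memLp f)).coeFn_toLp] with z h1 h2
    have h1' : L f z = M.slack z.1 * timeInt M.leb Set.Iic f z := h1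
    rw [h1', h2, norm_mul]
    gcongr
    exact hC _ trivial
  have h2 : ‖(MemLp.timeInt (A := Set.Iic) measurableSet_past (Lp.memLp f)).toLp _‖
      ≤ M.leb.real Set.univ * ‖f‖ := by
    rw [Lp.norm_toLp, Lp.norm_def, Measure.real, ← ENNReal.toReal_mul]
    exact ENNReal.toReal_mono (ENNReal.mul_ne_top (measure_ne_top _ _) (Lp.memLp f).2.ne)
      (eLpNorm_timeInt_le (Lp.memLp f).1)
  have hC0 : 0 ≤ C := (norm_nonneg _).trans (hC M.start trivial)
  calc ‖L f‖ ≤ C * (M.leb.real Set.univ * ‖f‖) := h1.trans (by gcongr)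
    _ = _ := by ring

theorem gainRate_ae_eq [IsProbabilityMeasure P]
    (htrunc : ∀ t : M.Time, IsTruncatedAt 1 (M.xiDelta t)) (hW : IsBrownianMotion P ℱ W)
    (hθ : MemLp (Function.uncurry θ) 2 (M.leb.prod P)) :
    (fun z : M.Time × Ω => M.gainRate P W θ z.1 z.2) =ᵐ[M.leb.prod P] fun z =>
      (M.μ + M.ν * θ z.1 z.2) * M.excess W θ z - M.η * θ z.1 z.2 ^ 2
        - M.lam / 2 * M.σ ^ 2 * M.excess W θ z ^ 2 := by
  have := (Measure.quasiMeasurePreserving_snd (μ := M.leb)).ae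
    (ae_delta_eq htrunc (ae_continuous_price_of_memLp hW hθ))
  filter_upwards [this] with z hz
  rw [gainRate, hz z.1]
  rfl

theorem integrable_gainRate_and_gain_eq [IsProbabilityMeasure P]
    (htrunc : ∀ t : M.Time, IsTruncatedAt 1 (M.xiDelta t)) (hW : IsBrownianMotion P ℱ W)
    (hθ : MemLp (Function.uncurry θ) 2 (M.leb.prod P)) :
    Integrable (fun z : M.Time × Ω => M.gainRate P W θ z.1 z.2) (M.leb.prod P) ∧
    M.gain P W θ = (∫ z, (M.μ + M.ν * θ z.1 z.2) * M.excess W θ z ∂(M.leb.prod P))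
      - M.η * (∫ z, θ z.1 z.2 ^ 2 ∂(M.leb.prod P))
      - M.lam / 2 * M.σ ^ 2 * ∫ z, M.excess W θ z ^ 2 ∂(M.leb.prod P) := by
  have hE := memLp_excess hW hθ
  have hc : MemLp (fun _ : M.Time × Ω => M.μ) 2 (M.leb.prod P) := memLp_const M.μ
  have hμ : MemLp (fun z => M.μ + M.ν * θ z.1 z.2) 2 (M.leb.prod P) := hc.add (hθ.const_mul M.ν)
  have i1 := integrable_mul_of_memLp_two hμ hE
  have i2 : Integrable (fun z => M.η * θ z.1 z.2 ^ 2) (M.leb.prod P) :=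
    hθ.integrable_sq.const_mul M.η
  have i3 := hE.integrable_sq.const_mul (M.lam / 2 * M.σ ^ 2)
  have i12 : Integrable (fun z => (M.μ + M.ν * θ z.1 z.2) * M.excess W θ z
    - M.η * θ z.1 z.2 ^ 2) (M.leb.prod P) := i1.sub i2
  have hae := gainRate_ae_eq htrunc hW hθ
  have hi := (i12.sub i3).congr hae.symm
  refine ⟨hi, ?_⟩
  rw [gain, ← integral_prod_symm _ hi, integral_congr_ae hae, integral_sub i12 i3,
    integral_sub i1 i2, integral_const_mul, integral_const_mul]

theorem gain_eq_quadraticGain [IsProbabilityMeasure P]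
    (htrunc : ∀ t : M.Time, IsTruncatedAt 1 (M.xiDelta t)) (hW : IsBrownianMotion P ℱ W)
    {K : Lp ℝ 2 (M.leb.prod P) →L[ℝ] Lp ℝ 2 (M.leb.prod P)}
    (hK : ∀ f : Lp ℝ 2 (M.leb.prod P),
      K f =ᵐ[M.leb.prod P] fun z => M.slack z.1 * timeInt M.leb Set.Iic f z)
    (hc : MemLp (fun _ : M.Time × Ω => M.μ) 2 (M.leb.prod P))
    (hh : MemLp (fun z => M.X₀ - M.baseHedge W z) 2 (M.leb.prod P))
    (hθ : MemLp (Function.uncurry θ) 2 (M.leb.prod P)) :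
    M.gain P W θ = quadraticGain K (hc.toLp _) (hh.toLp _) M.ν M.η (M.lam / 2 * M.σ ^ 2)
      (hθ.toLp _) := by
  rw [(integrable_gainRate_and_gain_eq htrunc hW hθ).2, quadraticGain,
    ← real_inner_self_eq_norm_sq, ← real_inner_self_eq_norm_sq, L2.inner_def, L2.inner_def,
    L2.inner_def]
  have hex : K (hθ.toLp _) + hh.toLp _ =ᵐ[M.leb.prod P] M.excess W θ := by
    filter_upwards [Lp.coeFn_add (K (hθ.toLp _)) (hh.toLp _), hK (hθ.toLp _), hh.coeFn_toLp,
      timeInt_ae_eq (A := Set.Iic) hθ.coeFn_toLp] with z h1 h2 h3 h4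
    rw [h1, Pi.add_apply, h2, h3, h4, excess_eq]
  have hb : hc.toLp _ + M.ν • hθ.toLp _ =ᵐ[M.leb.prod P] fun z => M.μ + M.ν * θ z.1 z.2 := by
    filter_upwards [Lp.coeFn_add (hc.toLp _) (M.ν • hθ.toLp _), hc.coeFn_toLp,
      Lp.coeFn_smul M.ν (hθ.toLp _), hθ.coeFn_toLp] with z h1 h2 h3 h4
    rw [h1, Pi.add_apply, h2, h3, Pi.smul_apply, h4]
    rfl
  congr 1
  · congr 1
    · refine integral_congr_ae ?_
      filter_upwards [hex, hb] with z h1 h2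
      rw [h1, h2]
      simp [mul_comm]
    · congr 1
      refine integral_congr_ae ?_
      filter_upwards [hθ.coeFn_toLp] with z h1
      rw [h1]
      simp [sq, Function.uncurry]
  · congr 1
    refine integral_congr_ae ?_
    filter_upwards [hex] with z h1
    rw [h1]
    simp [sq]

theorem coercive_slackTrades [SFinite P] (hν : 0 < M.ν) {ε : ℝ}
    (hbound : ∀ t : M.Time, 1 / M.ν * (1 - (2 * M.η - ε) / (M.T * M.ν)) ≤ M.xi t [L2, L2] ∧
      M.xi t [L2, L2] ≤ 1 / M.ν)
    {K : Lp ℝ 2 (M.leb.prod P) →L[ℝ] Lp ℝ 2 (M.leb.prod P)}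
    (hK : ∀ f : Lp ℝ 2 (M.leb.prod P),
      K f =ᵐ[M.leb.prod P] fun z => M.slack z.1 * timeInt M.leb Set.Iic f z)
    (f : Lp ℝ 2 (M.leb.prod P)) : M.ν * inner ℝ f (K f) ≤ (M.η - ε / 2) * ‖f‖ ^ 2 := by
  have h := mul_integral_slack_le hν hbound (Lp.memLp f)
  rw [← real_inner_self_eq_norm_sq, L2.inner_def, L2.inner_def]
  have h1 : ∫ z, inner ℝ (f z) (K f z) ∂(M.leb.prod P) =
      ∫ z, f z * (M.slack z.1 * timeInt M.leb Set.Iic f z) ∂(M.leb.prod P) := by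
    refine integral_congr_ae ?_
    filter_upwards [hK f] with z hz
    rw [hz]
    simp [mul_comm]
  have h2 : ∫ z, inner ℝ (f z) (f z) ∂(M.leb.prod P) = ∫ z, f z ^ 2 ∂(M.leb.prod P) := by
    simp [sq]
  rw [h1, h2]
  refine h.trans (le_of_eq ?_)
  ring

/-! ### The set of admissible controls in `L²` -/

/-- The classes in `L²(dt ⊗ P)` of progressively measurable processes. -/
noncomputable def progressiveClasses (M : Market) (P : Measure Ω) (ℱ : Filtration M.Time mΩ) :
    Set (Lp ℝ 2 (M.leb.prod P)) :=
  {f | ∃ θ : M.Time → Ω → ℝ, IsStronglyProgressive ℱ θ ∧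
    Function.uncurry θ =ᵐ[M.leb.prod P] f}

theorem isClosed_progressiveClasses : IsClosed (progressiveClasses M P ℱ) := by
  refine IsSeqClosed.isClosed fun u f hu hf => ?_
  choose θ hθ hθu using hu
  obtain ⟨ns, -, hns⟩ := (tendstoInMeasure_of_tendsto_Lp hf).exists_seq_tendsto_ae
  refine ⟨fun t ω => limUnder atTop fun k => θ (ns k) t ω, fun i => ?_, ?_⟩
  · exact @StronglyMeasurable.limUnder _ _ _ (Subtype.instMeasurableSpace.prod (ℱ i)) _ _ _ _ _ _ _
      fun k => hθ (ns k) i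
  · have hall : ∀ᵐ z ∂(M.leb.prod P), ∀ k, Function.uncurry (θ k) z = u k z :=
      ae_all_iff.2 hθu
    filter_upwards [hns, hall] with z h1 h2
    refine Tendsto.limUnder_eq (h1.congr fun k => ?_)
    exact (h2 (ns k)).symm

theorem midpoint_mem_progressiveClasses {x y : Lp ℝ 2 (M.leb.prod P)}
    (hx : x ∈ progressiveClasses M P ℱ) (hy : y ∈ progressiveClasses M P ℱ) :
    (1 / 2 : ℝ) • (x + y) ∈ progressiveClasses M P ℱ := by
  obtain ⟨θ, hθ, hθx⟩ := hx
  obtain ⟨φ, hφ, hφy⟩ := hy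
  refine ⟨fun t ω => (1 / 2 : ℝ) • (θ t ω + φ t ω), fun i => ?_, ?_⟩
  · exact ((hθ i).add (hφ i)).const_smul (1 / 2 : ℝ)
  · filter_upwards [hθx, hφy, Lp.coeFn_smul (1 / 2 : ℝ) (x + y), Lp.coeFn_add x y]
      with z h1 h2 h3 h4
    rw [h3, Pi.smul_apply, h4, Pi.add_apply, ← h1, ← h2]
    rfl

theorem exists_unique_optimal [IsProbabilityMeasure P] (hW : IsBrownianMotion P ℱ W)
    (hν : 0 < M.ν) (htrunc : ∀ t : M.Time, IsTruncatedAt 1 (M.xiDelta t)) {ε : ℝ} (hε : 0 < ε)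
    (hbound : ∀ t : M.Time, 1 / M.ν * (1 - (2 * M.η - ε) / (M.T * M.ν)) ≤ M.xi t [L2, L2] ∧
      M.xi t [L2, L2] ≤ 1 / M.ν) :
    ∃ θ : M.Time → Ω → ℝ, M.IsOptimal P ℱ W θ ∧
      ∀ φ : M.Time → Ω → ℝ, M.IsOptimal P ℱ W φ →
        ∀ᵐ z ∂(M.leb.prod P), φ z.1 z.2 = θ z.1 z.2 := by
  obtain ⟨K, hK⟩ := exists_slackTrades (M := M) (P := P)
  have hcoer := coercive_slackTrades hν hbound hK
  have hc : MemLp (fun _ : M.Time × Ω => M.μ) 2 (M.leb.prod P) := memLp_const M.μ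
  have hX : MemLp (fun _ : M.Time × Ω => M.X₀) 2 (M.leb.prod P) := memLp_const M.X₀
  have hh : MemLp (fun z => M.X₀ - M.baseHedge W z) 2 (M.leb.prod P) := hX.sub (memLp_baseHedge hW)
  have hpos : 0 ≤ M.lam / 2 * M.σ ^ 2 := mul_nonneg (half_pos M.lam_pos).le (sq_nonneg _)
  have hgain := fun {θ : M.Time → Ω → ℝ} (hθ : MemLp (Function.uncurry θ) 2 (M.leb.prod P)) =>
    gain_eq_quadraticGain htrunc hW hK hc hh hθ
  have hadm := fun {θ : M.Time → Ω → ℝ} =>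
    mem_admissible_iff (P := P) (ℱ := ℱ) (θ := θ) (M.exponent_eq_two htrunc)
  have hmid := quadraticGain_midpoint (hc.toLp _) (hh.toLp _) hpos hcoer
  have hmem : ∀ {θ : M.Time → Ω → ℝ} (_ : IsStronglyProgressive ℱ θ)
      (hθ : MemLp (Function.uncurry θ) 2 (M.leb.prod P)),
      hθ.toLp _ ∈ progressiveClasses M P ℱ := fun h hθ => ⟨_, h, hθ.coeFn_toLp.symm⟩
  obtain ⟨f, ⟨θ, pθ, hθf⟩, hmax⟩ := exists_isMaxOn_of_strongly_midpoint_concave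
    (continuous_quadraticGain K (hc.toLp _) (hh.toLp _) M.ν M.η (M.lam / 2 * M.σ ^ 2))
    (k := ε / 8) (by positivity) (isClosed_progressiveClasses (M := M) (P := P) (ℱ := ℱ))
    ⟨0, fun _ _ => 0, isStronglyProgressive_const ℱ 0, (Lp.coeFn_zero _ _ _).symm⟩
    (fun x hx y hy => midpoint_mem_progressiveClasses hx hy) hmid
    (bddAbove_quadraticGain _ _ hpos hε hcoer _)
  have hθ : MemLp (Function.uncurry θ) 2 (M.leb.prod P) := (memLp_congr_ae hθf).2 (Lp.memLp f)
  have hf : hθ.toLp _ = f := by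
    refine Lp.ext ?_
    filter_upwards [hθ.coeFn_toLp, hθf] with z h1 h2
    rw [h1, h2]
  have hopt : M.IsOptimal P ℱ W θ := by
    refine ⟨hadm.2 ⟨pθ, hθ⟩, fun φ hφ => ?_⟩
    obtain ⟨pφ, hφ⟩ := hadm.1 hφ
    rw [Set.mem_ofPred_eq, hgain hφ, hgain hθ, hf]
    exact hmax _ (hmem pφ hφ)
  refine ⟨θ, hopt, fun φ hφ => ?_⟩
  obtain ⟨pφ, hφ2⟩ := hadm.1 hφ.1
  have heq : hφ2.toLp _ = f := by
    refine eq_of_isMaxOn_of_strongly_midpoint_concave (k := ε / 8) (by positivity)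
      (fun x hx y hy => midpoint_mem_progressiveClasses hx hy) hmid (hmem pφ hφ2)
      ⟨θ, pθ, hθf⟩ (fun z hz => ?_) hmax
    rw [← hgain hφ2]
    refine (hmax z hz).trans ?_
    rw [← hf, ← hgain hθ]
    exact hφ.2 hopt.1
  filter_upwards [hφ2.coeFn_toLp, hθf] with z h1 h2
  rw [heq] at h1
  exact h1.symm.trans h2.symm

end Market

end SigHedging

theorem proposition5p4 {Ω : Type*} {mΩ : MeasurableSpace Ω} (P : Measure Ω)
    [IsProbabilityMeasure P] (M : SigHedging.Market) (ℱ : Filtration M.Time mΩ)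
    (W : M.Time → Ω → ℝ) (hℱ : SigHedging.UsualConditions P ℱ)
    (hW : SigHedging.IsBrownianMotion P ℱ W) (hν : 0 < M.ν)
    (htrunc : ∀ t : M.Time, SigHedging.IsTruncatedAt 1 (M.xiDelta t))
    (ε : ℝ) (hε : 0 < ε) (hε' : ε < 2 * M.η)
    (hbound : ∀ t : M.Time,
      1 / M.ν * (1 - (2 * M.η - ε) / (M.T * M.ν)) ≤ M.xi t [SigHedging.L2, SigHedging.L2] ∧
      M.xi t [SigHedging.L2, SigHedging.L2] ≤ 1 / M.ν) :
    M.MonotonicityCondition P ℱ W ε ∧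
    (∀ θ ∈ M.admissible P ℱ,
      Integrable (fun z : M.Time × Ω => M.gainRate P W θ z.1 z.2) (M.leb.prod P)) ∧
    ∃ θ : M.Time → Ω → ℝ, M.IsOptimal P ℱ W θ ∧
      ∀ φ : M.Time → Ω → ℝ, M.IsOptimal P ℱ W φ →
        ∀ᵐ z ∂(M.leb.prod P), φ z.1 z.2 = θ z.1 z.2 :=
  ⟨SigHedging.Market.monotonicityCondition hW hν htrunc hbound,
    fun _ hθ => (SigHedging.Market.integrable_gainRate_and_gain_eq htrunc hW
      ((SigHedging.Market.mem_admissible_iff (M.exponent_eq_two htrunc)).1 hθ).2).1,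
    SigHedging.Market.exists_unique_optimal hW hν htrunc hε hbound⟩
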